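/- Let $n\ge 2$ and let $\mathbb{H}^n=\{y=(\underline y,y_0)\in\mathbb{R}^n\times\mathbb{R}:\langle y,y\rangle_1=-1,\ y_0>0\}$ be the hyperboloid model, where $\langle x,y\rangle_1=\langle\underline x,\underline y\rangle-x_0y_0$. A partition $\Omega=(\Omega_1,\dots,\Omega_q)$ of $\mathbb{H}^n$ consists of pairwise disjoint Borel sets (cells) of locally finite perimeter, only finitely many of which meet any given compact set, whose union has full volume; its interfaces are $\Sigma_{ij}=\partial^*\Omega_i\cap\partial^*\Omega_j$ ($i\neq j$), where $\partial^*$ is the reduced boundary. It is a $k$-cluster, $k=q-1\geq 1$ finite, if $\Omega_1,\dots,\Omega_{q-1}$ have finite volume and finite perimeter. A generalized sphere is a complete hypersurface $S$ of constant curvature $\kappa$ with respect to a unit normal $\mathbf{n}$ (that is, $\mathrm{II}=\kappa g$); its quasi-center is $\mathbf{c}=\mathbf{n}-\kappa p$, $p\in S$. A partition with non-empty cells is spherical Voronoi, with parameters $\mathbf{c}_i\in\mathbb{R}^{n}\times\mathbb{R}$, $\kappa_i\in\mathbb{R}$, if every non-empty $\Sigma_{ij}$ is a relatively open subset of a generalized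 sphere with quasi-center $\mathbf{c}_{ij}=\mathbf{c}_i-\mathbf{c}_j$ and curvature $\kappa_{ij}=\kappa_i-\kappa_j$, and $$\Omega_i=\bigcap_{j\ne i}\{y\in\mathbb{H}^n:\langle \mathbf{c}_{ij},y\rangle_1-\kappa_{ij}<0\}\quad\text{for all } i.$$ It is Möbius-flat if there is a Möbius automorphism of $\mathbb{S}^n$ that maps the images of all non-empty interfaces under the stereographic projection $\pi_{\mathbb{H}}(y)=(\underline y,1)/y_0$ into geodesic spheres of zero curvature (great spheres). A vector $\xi=(\underline\xi,\xi_0)\in\mathbb{R}^n\times\mathbb{R}$ is admissible (for given parameters) if $|\underline\xi|^2+\xi_0^2<1$ and $\langle \mathbf{c}_{ij},(\underline\xi,1)\rangle_1-\kappa_{ij}\xi_0=0$ whenever $\Sigma_{ij}\ne\emptyset$. A Möbius-flat spherical Voronoi partition is hypo-Möbius-flat if it has an admissible $\xi$ with $\xi_0\le 0$, and epi-Möbius-flat otherwise. **Proposition.** Any Möbius-flat, spherical Voronoi cluster $\Omega$ in $\mathbb{H}^n$ is necessarily epi-Möbius-flat. In other words, every admissible $\xi$, for any choice of parameters of $\Omega$,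 has $\xi_0>0$. In particular, for every admissible $\xi$ the function $V(y)=-\xi_0-\langle y,(\underline\xi,1)\rangle_1$ is positive on $\mathbb{H}^n$ and satisfies $L_{Jac}V=(n-1)\xi_0>0$ on every interface, where $L_{Jac}f=\Delta_{\Sigma}f+(\mathrm{Ric}_{\mathbb{H}^n}(\mathbf{n},\mathbf{n})+\|\mathrm{II}\|^2)f$ is the Jacobi operator; so the condition $L_{Jac}V\le 0$ never holds for this $V$ at any point of an interface. -/

import Mathlib

open Set Filter Topology MeasureTheory
open scoped ENNReal

noncomputable section

namespace HypVoronoi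

/-! ### Minkowski space and the hyperboloid model -/

/-- The vector space `ℝⁿ × ℝ = ℝⁿ⁺¹`, with its Euclidean norm; it also carries `mink`. The
coordinate `v 0` is the distinguished ("time") coordinate `v₀`, and `space v` is `v̲ ∈ ℝⁿ`. -/
abbrev Vec (n : ℕ) : Type := EuclideanSpace ℝ (Fin (n + 1))

/-- The component `v̲ ∈ ℝⁿ` of `v = (v̲, v₀)`. -/
def space {n : ℕ} (v : Vec n) : EuclideanSpace ℝ (Fin n) := WithLp.toLp 2 fun i => v i.succ

/-- The vector `(x, t) ∈ ℝⁿ × ℝ`. -/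
def vec {n : ℕ} (x : EuclideanSpace ℝ (Fin n)) (t : ℝ) : Vec n :=
  WithLp.toLp 2 (Fin.cons t fun i => x i)

/-- The Minkowski form `⟨x, y⟩₁ = ∑ xᵢ yᵢ - x₀ y₀`. -/
def mink {n : ℕ} (x y : Vec n) : ℝ := inner ℝ (space x) (space y) - x 0 * y 0

/-- Hyperbolic `n`-space: the upper sheet `⟨y, y⟩₁ = -1`, `y₀ > 0` of the hyperboloid. -/
@[ext]
structure Hyp (n : ℕ) where
  val : Vec n
  mink_self : mink val val = -1
  time_pos : 0 < val 0

section metric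

variable {n : ℕ}

@[simp] theorem space_add (x y : Vec n) : space (x + y) = space x + space y := rfl
@[simp] theorem space_smul (a : ℝ) (x : Vec n) : space (a • x) = a • space x := rfl
@[simp] theorem space_vec (x : EuclideanSpace ℝ (Fin n)) (t : ℝ) : space (vec x t) = x := by
  ext i; simp [space, vec]
@[simp] theorem vec_zero (x : EuclideanSpace ℝ (Fin n)) (t : ℝ) : vec x t 0 = t := by
  simp [vec]

theorem norm_sq_eq (v : Vec n) : ‖v‖ ^ 2 = ‖space v‖ ^ 2 + v 0 ^ 2 := by
  rw [EuclideanSpace.norm_sq_eq, EuclideanSpace.norm_sq_eq, Fin.sum_univ_succ]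
  simp [space, add_comm]

theorem mink_comm (x y : Vec n) : mink x y = mink y x := by
  simp only [mink, real_inner_comm, mul_comm]

theorem mink_add_left (x y z : Vec n) : mink (x + y) z = mink x z + mink y z := by
  simp only [mink, space_add, PiLp.add_apply, inner_add_left]; ring

theorem mink_smul_left (a : ℝ) (x z : Vec n) : mink (a • x) z = a * mink x z := by
  simp only [mink, space_smul, PiLp.smul_apply, real_inner_smul_left, smul_eq_mul]; ring

theorem mink_add_right (x y z : Vec n) : mink x (y + z) = mink x y + mink x z := by
  rw [mink_comm, mink_add_left, mink_comm y, mink_comm z]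

theorem mink_smul_right (a : ℝ) (x z : Vec n) : mink x (a • z) = a * mink x z := by
  rw [mink_comm, mink_smul_left, mink_comm]

theorem Hyp.norm_space_sq (y : Hyp n) : ‖space y.val‖ ^ 2 = y.val 0 ^ 2 - 1 := by
  have h := y.mink_self
  simp only [mink, real_inner_self_eq_norm_sq] at h
  linarith

theorem time_sq_le (y : Hyp n) (w : Vec n) (hw : mink w y.val = 0) :
    w 0 ^ 2 * y.val 0 ^ 2 ≤ ‖space w‖ ^ 2 * (y.val 0 ^ 2 - 1) := by
  have h1 : inner ℝ (space w) (space y.val) = w 0 * y.val 0 := by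
    simp only [mink] at hw; linarith
  have h2 := abs_real_inner_le_norm (space w) (space y.val)
  rw [h1] at h2
  have h3 := pow_le_pow_left₀ (abs_nonneg _) h2 2
  rw [sq_abs, mul_pow, mul_pow, y.norm_space_sq] at h3
  exact h3

theorem mink_self_nonneg (y : Hyp n) (w : Vec n) (hw : mink w y.val = 0) : 0 ≤ mink w w := by
  have h := time_sq_le y w hw
  have hy := y.time_pos
  simp only [mink, real_inner_self_eq_norm_sq]
  have h4 : 0 ≤ (‖space w‖ ^ 2 - w 0 * w 0) * y.val 0 ^ 2 := by
    nlinarith [sq_nonneg ‖space w‖]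
  exact nonneg_of_mul_nonneg_left h4 (by positivity)

theorem eq_zero_of_mink (y : Hyp n) (w : Vec n) (hw : mink w y.val = 0) (h0 : mink w w = 0) :
    w = 0 := by
  have h := time_sq_le y w hw
  simp only [mink, real_inner_self_eq_norm_sq] at h0
  have h1 : ‖space w‖ ^ 2 = w 0 ^ 2 := by nlinarith
  rw [h1] at h
  have h2 : w 0 = 0 := by
    have : w 0 ^ 2 ≤ 0 := by nlinarith
    exact pow_eq_zero_iff (two_ne_zero) |>.1 (le_antisymm this (sq_nonneg _))
  have h3 : space w = 0 := by
    rw [h2] at h1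
    simpa using h1
  have h4 := norm_sq_eq w
  rw [h2, h3] at h4
  simpa using h4

/-- Hyperbolic distance, `cosh d(x, y) = -⟨x, y⟩₁`. -/
def hdist (x y : Hyp n) : ℝ := Real.arcosh (-mink x.val y.val)

theorem proj_orth (x y : Hyp n) : mink (x.val + mink x.val y.val • y.val) y.val = 0 := by
  rw [mink_add_left, mink_smul_left, y.mink_self]; ring

theorem proj_self (x y : Hyp n) :
    mink (x.val + mink x.val y.val • y.val) (x.val + mink x.val y.val • y.val)
      = mink x.val y.val ^ 2 - 1 := by
  rw [mink_add_right, mink_smul_right, proj_orth, mink_add_left, mink_smul_left, x.mink_self,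
    mink_comm y.val x.val]
  ring

theorem one_le_neg_mink (x y : Hyp n) : 1 ≤ -mink x.val y.val := by
  have h := mink_self_nonneg y _ (proj_orth x y)
  rw [proj_self] at h
  have hpos : 0 < -mink x.val y.val := by
    have hx := x.norm_space_sq
    have hy := y.norm_space_sq
    have hx0 := x.time_pos
    have hy0 := y.time_pos
    have h1 : ‖space x.val‖ < x.val 0 := by
      apply lt_of_pow_lt_pow_left₀ 2 hx0.le; linarith
    have h2 : ‖space y.val‖ < y.val 0 := by
      apply lt_of_pow_lt_pow_left₀ 2 hy0.le; linarith
    have h3 := real_inner_le_norm (space x.val) (space y.val)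
    have h4 : ‖space x.val‖ * ‖space y.val‖ < x.val 0 * y.val 0 :=
      mul_lt_mul'' h1 h2 (norm_nonneg _) (norm_nonneg _)
    simp only [mink]; linarith
  nlinarith

theorem hdist_triangle (x y z : Hyp n) : hdist x z ≤ hdist x y + hdist y z := by
  have hA := one_le_neg_mink x y
  have hB := one_le_neg_mink y z
  have hC := one_le_neg_mink x z
  have ha : 0 ≤ hdist x y := Real.arcosh_nonneg hA
  have hb : 0 ≤ hdist y z := Real.arcosh_nonneg hB
  rw [← Real.arcosh_cosh (add_nonneg ha hb)]
  unfold hdist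
  rw [Real.arcosh_le_arcosh (by linarith) (Real.cosh_pos _), Real.cosh_add,
    Real.cosh_arcosh hA, Real.cosh_arcosh hB, Real.sinh_arcosh hA, Real.sinh_arcosh hB,
    ← Real.sqrt_mul (by nlinarith)]
  set u := x.val + mink x.val y.val • y.val with hu
  set w := z.val + mink z.val y.val • y.val with hw
  have huu : mink u u = mink x.val y.val ^ 2 - 1 := proj_self x y
  have hww : mink w w = mink z.val y.val ^ 2 - 1 := proj_self z y
  have huw : mink u w = mink x.val z.val + mink x.val y.val * mink z.val y.val := by
    rw [hw, mink_add_right, mink_smul_right, proj_orth, hu, mink_add_left, mink_smul_left,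
      mink_comm y.val z.val]
    ring
  have hq : ∀ t : ℝ, 0 ≤ mink w w * (t * t) + (2 * mink u w) * t + mink u u := by
    intro t
    have h := mink_self_nonneg y (u + t • w) (by
      rw [mink_add_left, mink_smul_left, proj_orth, proj_orth]; ring)
    have he : mink (u + t • w) (u + t • w)
        = mink u u + 2 * t * mink u w + t * t * mink w w := by
      simp only [mink_add_right, mink_add_left u, mink_smul_right, mink_smul_left,
        mink_comm w u]
      ring
    linarith
  have hd := discrim_le_zero hq
  unfold discrim at hd
  have hsq : (mink u w) ^ 2 ≤ ((-mink x.val y.val) ^ 2 - 1) * ((-mink y.val z.val) ^ 2 - 1) := by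
    rw [huu, hww, mink_comm z.val y.val] at hd
    nlinarith
  have := Real.abs_le_sqrt hsq
  rw [huw, mink_comm z.val y.val] at this
  have h2 := (abs_le.1 this).1
  nlinarith

end metric

instance instMetricSpaceHyp (n : ℕ) : MetricSpace (Hyp n) where
  dist := hdist
  dist_self x := by
    simp [hdist, x.mink_self]
  dist_comm x y := by
    simp [hdist, mink_comm]
  dist_triangle := hdist_triangle
  eq_of_dist_eq_zero := by
    intro x y h
    change hdist x y = 0 at h
    rw [hdist, Real.arcosh_eq_zero_iff (one_le_neg_mink x y)] at h
    have h1 : mink x.val y.val = -1 := by linarith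
    have h2 := proj_self x y
    have h3 := eq_zero_of_mink y _ (proj_orth x y) (by rw [h2, h1]; norm_num)
    rw [h1] at h3
    apply Hyp.ext
    have h4 : x.val - y.val = 0 := by
      rw [← h3]; module
    exact sub_eq_zero.1 h4

instance instMeasurableSpaceHyp (n : ℕ) : MeasurableSpace (Hyp n) := borel _

instance instBorelSpaceHyp (n : ℕ) : BorelSpace (Hyp n) := ⟨rfl⟩

/-- The global graph chart `ℝⁿ → ℍⁿ`, `x ↦ (x, √(1 + |x|²))`; its inverse is
`y ↦ space y.val`. -/
def ofChart {n : ℕ} (x : EuclideanSpace ℝ (Fin n)) : Hyp n where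
  val := vec x (Real.sqrt (1 + ‖x‖ ^ 2))
  mink_self := by
    have h : 0 ≤ 1 + ‖x‖ ^ 2 := by positivity
    rw [mink, space_vec, vec_zero, Real.mul_self_sqrt h, real_inner_self_eq_norm_sq]; ring
  time_pos := by
    rw [vec_zero]
    positivity

/-- Hyperbolic volume: in the graph chart the metric is `|dx|² - ⟨x, dx⟩² / (1 + |x|²)`, whose
Riemannian volume density is `1 / √(1 + |x|²)`. -/
def hypVolume {n : ℕ} (U : Set (Hyp n)) : ℝ≥0∞ :=
  ∫⁻ x in ofChart ⁻¹' U, ENNReal.ofReal (1 / Real.sqrt (1 + ‖x‖ ^ 2))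

/-! ### Sets of locally finite perimeter and reduced boundary -/

/-- The divergence of a vector field on `ℝⁿ`. -/
def divergence {n : ℕ} (X : EuclideanSpace ℝ (Fin n) → EuclideanSpace ℝ (Fin n))
    (x : EuclideanSpace ℝ (Fin n)) : ℝ :=
  ∑ i, (fderiv ℝ X x (EuclideanSpace.single i 1)) i

/-- `ν τ` is the Gauss-Green measure of `U ⊆ ℝⁿ` in polar form: `τ` is a Radon measure,
`|ν| = 1` `τ`-a.e. and `∫_U div X = ∫ ⟨X, ν⟩ dτ` for all `X ∈ C¹_c(ℝⁿ; ℝⁿ)`. -/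
structure IsGaussGreen {n : ℕ} (U : Set (EuclideanSpace ℝ (Fin n)))
    (τ : Measure (EuclideanSpace ℝ (Fin n)))
    (ν : EuclideanSpace ℝ (Fin n) → EuclideanSpace ℝ (Fin n)) : Prop where
  locallyFinite : IsLocallyFiniteMeasure τ
  measurable : Measurable ν
  unit : ∀ᵐ x ∂τ, ‖ν x‖ = 1
  gauss_green : ∀ X : EuclideanSpace ℝ (Fin n) → EuclideanSpace ℝ (Fin n),
    ContDiff ℝ 1 X → HasCompactSupport X →
      ∫ x in U, divergence X x = ∫ x, inner ℝ (X x) (ν x) ∂τ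

/-- The reduced boundary of `U ⊆ ℝⁿ`: points `x` of the support of the perimeter measure at
which the averages of `ν` on balls converge to a unit vector (the measure-theoretic outer
normal). The pair `(τ, ν)` is determined by `U`, up to `τ`-null modifications of `ν`. -/
def reducedBoundaryEuclidean {n : ℕ} (U : Set (EuclideanSpace ℝ (Fin n))) :
    Set (EuclideanSpace ℝ (Fin n)) :=
  {x | ∃ τ ν, IsGaussGreen U τ ν ∧ (∀ r > 0, 0 < τ (Metric.ball x r)) ∧
    ∃ e : EuclideanSpace ℝ (Fin n), ‖e‖ = 1 ∧
      Tendsto (fun r : ℝ => ⨍ y in Metric.ball x r, ν y ∂τ) (𝓝[>] 0) (𝓝 e)}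

/-- Locally finite perimeter in `ℍⁿ`, read in the global chart. -/
def LocallyFinitePerimeter {n : ℕ} (U : Set (Hyp n)) : Prop :=
  ∃ τ ν, IsGaussGreen (ofChart ⁻¹' U) τ ν

/-- The reduced boundary `∂*U` in `ℍⁿ`, read in the global chart (it is invariant under
diffeomorphisms). -/
def reducedBoundary {n : ℕ} (U : Set (Hyp n)) : Set (Hyp n) :=
  {p | space p.val ∈ reducedBoundaryEuclidean (ofChart ⁻¹' U)}

/-- Hyperbolic perimeter `A(U) = 𝓗ⁿ⁻¹(∂*U)`. -/
def perimeter {n : ℕ} (U : Set (Hyp n)) : ℝ≥0∞ :=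
  Measure.hausdorffMeasure ((n : ℝ) - 1) (reducedBoundary U)

/-! ### Partitions, clusters, interfaces -/

/-- The interface `Σᵢⱼ = ∂*Ωᵢ ∩ ∂*Ωⱼ`. -/
def interface {n : ℕ} {ι : Type*} (Ω : ι → Set (Hyp n)) (i j : ι) : Set (Hyp n) :=
  reducedBoundary (Ω i) ∩ reducedBoundary (Ω j)

/-- A (locally finite) partition of `ℍⁿ`. -/
structure IsPartition {n : ℕ} {ι : Type*} (Ω : ι → Set (Hyp n)) : Prop where
  measurable : ∀ i, MeasurableSet (Ω i)
  perimeter : ∀ i, LocallyFinitePerimeter (Ω i)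
  disjoint : Pairwise fun i j => Disjoint (Ω i) (Ω j)
  cover : hypVolume (⋃ i, Ω i)ᶜ = 0
  locallyFinite : ∀ K : Set (Hyp n), IsCompact K → {i | (Ω i ∩ K).Nonempty}.Finite

/-- A `k`-cluster, as a partition with `k` cells (the bubbles) of finite volume and perimeter
and a last, exterior, cell. -/
structure IsCluster {n k : ℕ} (Ω : Fin (k + 1) → Set (Hyp n)) : Prop where
  partition : IsPartition Ω
  finite_volume : ∀ i, i ≠ Fin.last k → hypVolume (Ω i) < ∞
  finite_perimeter : ∀ i, i ≠ Fin.last k → perimeter (Ω i) < ∞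

/-! ### Generalized spheres and spherical Voronoi partitions -/

/-- `S ⊆ ℍⁿ` is a generalized sphere of curvature `κ` with respect to the unit normal `ν`:
a complete (properly embedded, connected) hypersurface whose second fundamental form is `κ`
times the metric, i.e. `D_u ν = κ u` for all tangent vectors `u`. -/
structure IsGeneralizedSphere {n : ℕ} (S : Set (Hyp n)) (ν : Hyp n → Vec n) (κ : ℝ) : Prop where
  closed : IsClosed S
  connected : IsConnected S
  normal_tangent : ∀ p ∈ S, mink (ν p) p.val = 0
  normal_unit : ∀ p ∈ S, mink (ν p) (ν p) = 1
  /-- Near each point, `S` is a smooth regular level set with normal direction `ν`. -/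
  hypersurface : ∀ p ∈ S, ∃ φ : Vec n → ℝ, ContDiff ℝ ((⊤ : ℕ∞) : WithTop ℕ∞) φ ∧
    (∀ᶠ y in 𝓝 p, y ∈ S ↔ φ y.val = 0) ∧
    ∃ a : ℝ, a ≠ 0 ∧ ∀ u, mink u p.val = 0 → fderiv ℝ φ p.val u = a * mink (ν p) u
  curvature : ∀ γ : ℝ → Hyp n, (∀ t, γ t ∈ S) → ∀ (t : ℝ) (u : Vec n),
    HasDerivAt (fun s => (γ s).val) u t → HasDerivAt (fun s => ν (γ s)) (κ • u) t

/-- `c` is the quasi-center `ν - κ p` (for every `p ∈ S`). -/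
def HasQuasiCenter {n : ℕ} (S : Set (Hyp n)) (ν : Hyp n → Vec n) (κ : ℝ) (c : Vec n) : Prop :=
  ∀ p ∈ S, ν p - κ • p.val = c

/-- `c`, `κ` are quasi-center and curvature parameters of the spherical Voronoi partition `Ω`. -/
structure IsVoronoiParam {n : ℕ} {ι : Type*} (Ω : ι → Set (Hyp n)) (c : ι → Vec n)
    (κ : ι → ℝ) : Prop where
  /-- Every non-empty interface is a relatively open subset of a generalized sphere with
  quasi-center `cᵢ - cⱼ` and curvature `κᵢ - κⱼ`. -/
  interface_sphere : ∀ i j, i ≠ j → (interface Ω i j).Nonempty →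
    ∃ (S : Set (Hyp n)) (ν : Hyp n → Vec n), IsGeneralizedSphere S ν (κ i - κ j) ∧
      HasQuasiCenter S ν (κ i - κ j) (c i - c j) ∧
      ∃ O : Set (Hyp n), IsOpen O ∧ interface Ω i j = O ∩ S
  /-- The cells are the strict minimality regions of the functions `⟨cⱼ, y⟩₁ - κⱼ`. -/
  cell : ∀ i, Ω i = {y | ∀ j, j ≠ i → mink (c i) y.val - κ i < mink (c j) y.val - κ j}

/-- A spherical Voronoi partition of `ℍⁿ`. -/
structure IsSphericalVoronoi {n : ℕ} {ι : Type*} (Ω : ι → Set (Hyp n)) : Prop where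
  partition : IsPartition Ω
  nonempty : ∀ i, (Ω i).Nonempty
  param : ∃ c κ, IsVoronoiParam Ω c κ

/-! ### Möbius-flatness -/

/-- The unit sphere `𝕊ⁿ ⊆ ℝⁿ⁺¹`. -/
abbrev Sph (n : ℕ) : Type := Metric.sphere (0 : Vec n) 1

/-- The stereographic projection `π(y) = (y̲, 1) / y₀` of `ℍⁿ` onto the open Northern
hemisphere. -/
def stereo {n : ℕ} (y : Hyp n) : Sph n :=
  ⟨(1 / y.val 0) • vec (space y.val) 1, by
    have h0 := y.time_pos
    have h1 : ‖vec (space y.val) 1‖ = y.val 0 := by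
      rw [← Real.sqrt_sq (norm_nonneg _), norm_sq_eq, space_vec, vec_zero, y.norm_space_sq,
        one_pow, sub_add_cancel, Real.sqrt_sq h0.le]
    rw [mem_sphere_zero_iff_norm, norm_smul, h1, Real.norm_of_nonneg (by positivity)]
    field_simp⟩

/-- The group of Möbius automorphisms of `𝕊ⁿ`, generated by the restrictions to `𝕊ⁿ` of linear
isometries and of inversions in spheres orthogonal to `𝕊ⁿ`. -/
def mobiusGroup (n : ℕ) : Subgroup (Equiv.Perm (Sph n)) :=
  Subgroup.closure
    ({T | ∃ L : Vec n ≃ₗᵢ[ℝ] Vec n, ∀ p : Sph n, (T p : Vec n) = L p} ∪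
     {T | ∃ a : Vec n, 1 < ‖a‖ ∧ ∀ p : Sph n,
        (T p : Vec n) = EuclideanGeometry.inversion a (Real.sqrt (‖a‖ ^ 2 - 1)) (p : Vec n)})

/-- The great sphere (geodesic sphere of zero curvature) orthogonal to `a`. -/
def greatSphere {n : ℕ} (a : Vec n) : Set (Sph n) := {p | inner ℝ a (p : Vec n) = 0}

/-- `Ω` is Möbius-flat: a single Möbius automorphism of `𝕊ⁿ` maps the stereographic projections
of all non-empty interfaces into great spheres. (As these are non-empty relatively open subsets
of geodesic spheres, this says that the spheres themselves are mapped to great spheres.) -/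
def IsMobiusFlat {n : ℕ} {ι : Type*} (Ω : ι → Set (Hyp n)) : Prop :=
  ∃ T ∈ mobiusGroup n, ∀ i j, i ≠ j → (interface Ω i j).Nonempty →
    ∃ a : Vec n, ‖a‖ = 1 ∧ T '' (stereo '' interface Ω i j) ⊆ greatSphere a

/-- The condition on `ξ = (ξ̲, ξ₀)`: `|ξ| < 1`, and `⟨cᵢⱼ, (ξ̲, 1)⟩₁ - κᵢⱼ ξ₀ = 0` for all
non-empty interfaces. -/
def IsAdmissible {n : ℕ} {ι : Type*} (Ω : ι → Set (Hyp n)) (c : ι → Vec n) (κ : ι → ℝ)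
    (ξ : Vec n) : Prop :=
  ‖ξ‖ < 1 ∧ ∀ i j, i ≠ j → (interface Ω i j).Nonempty →
    mink (c i - c j) (vec (space ξ) 1) - (κ i - κ j) * ξ 0 = 0

/-- Hypo-Möbius-flat: Möbius-flat spherical Voronoi, with an admissible `ξ` with `ξ₀ ≤ 0`. -/
def IsHypoMobiusFlat {n : ℕ} {ι : Type*} (Ω : ι → Set (Hyp n)) : Prop :=
  IsSphericalVoronoi Ω ∧ IsMobiusFlat Ω ∧
    ∃ c κ, IsVoronoiParam Ω c κ ∧ ∃ ξ, IsAdmissible Ω c κ ξ ∧ ξ 0 ≤ 0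

/-- Epi-Möbius-flat: Möbius-flat spherical Voronoi, and not hypo-Möbius-flat. -/
def IsEpiMobiusFlat {n : ℕ} {ι : Type*} (Ω : ι → Set (Hyp n)) : Prop :=
  IsSphericalVoronoi Ω ∧ IsMobiusFlat Ω ∧ ¬ IsHypoMobiusFlat Ω

/-! ### The potential attached to `ξ` and the Jacobi operator -/

/-- `V(y) = -ξ₀ - ⟨y, (ξ̲, 1)⟩₁`. -/
def potential {n : ℕ} (ξ y : Vec n) : ℝ := -ξ 0 - mink y (vec (space ξ) 1)

/-- `e` is an orthonormal basis of the tangent space at `p` of a hypersurface of `ℍⁿ` with unit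
normal `ν` at `p`. -/
structure IsTangentFrame {n : ℕ} (p : Hyp n) (ν : Vec n) (e : Fin (n - 1) → Vec n) : Prop where
  tangent : ∀ a, mink (e a) p.val = 0
  orth_normal : ∀ a, mink (e a) ν = 0
  orthonormal : ∀ a b, mink (e a) (e b) = if a = b then 1 else 0

/-- The Jacobi operator `L f = Δ_S f + (Ric(ν, ν) + ‖II‖²) f` at the point `p` of an umbilical
hypersurface `S ⊆ ℍⁿ` of curvature `κ`, unit normal `ν` at `p`, with orthonormal frame `e`:
here `Δ_S f = ∑ₐ ∇²f(eₐ, eₐ) - H ∂_ν f`, the Hessian and the normal derivative are computed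
along the geodesics `cosh s • p + sinh s • u` of `ℍⁿ`, `H = (n-1) κ`, `Ric(ν, ν) = -(n-1)`,
`‖II‖² = (n-1) κ²`. -/
def jacobi {n : ℕ} (f : Vec n → ℝ) (p : Hyp n) (ν : Vec n) (κ : ℝ)
    (e : Fin (n - 1) → Vec n) : ℝ :=
  (∑ a, iteratedDeriv 2 (fun s : ℝ => f (Real.cosh s • p.val + Real.sinh s • e a)) 0)
    - ((n : ℝ) - 1) * κ * deriv (fun s : ℝ => f (Real.cosh s • p.val + Real.sinh s • ν)) 0
    + (-((n : ℝ) - 1) + ((n : ℝ) - 1) * κ ^ 2) * f p.val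

end HypVoronoi

end

noncomputable section

namespace HypVoronoi

open scoped ContDiff Manifold

/-! ### Sign of a function from its integrals against test functions -/

/-! Compare the exterior cell with a neighbouring bubble `j`. Let `d`, `l` be the differences of
their parameters (exterior minus bubble), so `F(y) = ⟨d, y⟩₁ - l` is negative on the exterior cell
and positive on the bubble. If `⟨d̲, e⟩ > d₀` for some unit `e`, then `F > 0` on a cone around `e`
near infinity (`exists_chartFun_pos`). This cone misses the exterior cell but has infinite volume
(`le_chartVolume_ball`), whereas the bubbles have finite total volume. Hence `|d̲| ≤ d₀`
(`IsVoronoiParam.inner_space_le`), so `⟨d, ·⟩₁ ≤ 0` on the hyperboloid, and `F > 0` somewhere forces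
`l < 0`. Admissibility says `⟨d̲, ξ̲⟩ - d₀ = l ξ₀`. If `ξ₀ ≤ 0`, the right side is nonnegative,
while the left is at most `d₀ (|ξ̲| - 1) ≤ 0`; so `d = 0` and `F = -l > 0` everywhere, contradicting
`F < 0` on the exterior cell.

Admissibility only constrains pairs with a non-empty interface, so the exterior cell needs a
neighbour in the sense of reduced boundaries. `exists_regular_boundary_point` finds a boundary point
where exactly one other cell competes, and there the cell is a regular sublevel set.
`IsGaussGreen.mem_reducedBoundaryEuclidean` shows that such a point lies in the reduced boundary:
test fields identify the measure-theoretic normal with the normalized gradient, and balls around the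
point have positive perimeter measure. -/

theorem setIntegral_isCompact_nonneg_of_integral_contDiff_smul_nonneg {n : ℕ}
    {μ : Measure (EuclideanSpace ℝ (Fin n))} {f : EuclideanSpace ℝ (Fin n) → ℝ}
    (hf : LocallyIntegrable f μ) {U : Set (EuclideanSpace ℝ (Fin n))} (hU : IsOpen U)
    (h : ∀ φ : EuclideanSpace ℝ (Fin n) → ℝ, ContDiff ℝ ∞ φ → HasCompactSupport φ →
      tsupport φ ⊆ U → (∀ x, 0 ≤ φ x) → 0 ≤ ∫ x, φ x * f x ∂μ)
    {s : Set (EuclideanSpace ℝ (Fin n))} (hs : IsCompact s) (hsU : s ⊆ U) :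
    0 ≤ ∫ x in s, f x ∂μ := by
  obtain ⟨δ₁, δ₁pos, hδ₁⟩ := hs.exists_isCompact_cthickening
  obtain ⟨δ₂, δ₂pos, hδ₂⟩ := hs.exists_cthickening_subset_open hU hsU
  -- `δ₁` keeps the thickening compact, for domination; `δ₂` keeps it inside `U`, for the hypothesis
  -- on test functions. The smooth bumps below equal 1 on `s`, and their supports shrink to `s`.
  set δ := min δ₁ δ₂
  have δpos : 0 < δ := lt_min δ₁pos δ₂pos
  obtain ⟨u, -, u_pos, u_lim⟩ : ∃ u, StrictAnti u ∧ (∀ (n : ℕ), u n ∈ Ioo 0 δ)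
    ∧ Tendsto u atTop (𝓝 0) := exists_seq_strictAnti_tendsto' δpos
  let v : ℕ → Set (EuclideanSpace ℝ (Fin n)) := fun n ↦ Metric.thickening (u n) s
  have vK : ∀ n, v n ⊆ Metric.cthickening δ s :=
    fun n ↦ Metric.thickening_subset_cthickening_of_le (u_pos n).2.le _
  have hK1 : Metric.cthickening δ s ⊆ Metric.cthickening δ₁ s :=
    Metric.cthickening_mono (min_le_left _ _) _
  have hK : IsCompact (Metric.cthickening δ s) :=
    hδ₁.of_isClosed_subset Metric.isClosed_cthickening hK1
  have hKU : Metric.cthickening δ s ⊆ U :=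
    (Metric.cthickening_mono (min_le_right _ _) _).trans hδ₂
  have : ∀ m, ∃ g : EuclideanSpace ℝ (Fin n) → ℝ, Function.support g = v m ∧ ContDiff ℝ ∞ g ∧
      Set.range g ⊆ Set.Icc 0 1 ∧ ∀ x ∈ s, g x = 1 := by
    intro m
    rcases exists_contMDiff_support_eq_eq_one_iff 𝓘(ℝ, EuclideanSpace ℝ (Fin n))
      Metric.isOpen_thickening hs.isClosed
      (Metric.self_subset_thickening (u_pos m).1 s) with ⟨g, g_smooth, g_range, g_supp, hg⟩
    exact ⟨g, g_supp, g_smooth.contDiff, g_range, fun x hx ↦ (hg x).1 hx⟩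
  choose g g_supp g_diff g_range hg using this
  have L : Tendsto (fun m ↦ ∫ x, g m x * f x ∂μ) atTop (𝓝 (∫ x in s, f x ∂μ)) := by
    rw [← integral_indicator hs.measurableSet]
    refine tendsto_integral_of_dominated_convergence
      ((Metric.cthickening δ s).indicator fun x ↦ ‖f x‖)
      (fun m ↦ (g_diff m).continuous.aestronglyMeasurable.mul hf.aestronglyMeasurable) ?_ ?_ ?_
    · rw [integrable_indicator_iff hK.measurableSet]
      exact (hf.integrableOn_isCompact hK).norm
    · intro m
      filter_upwards with x
      rw [norm_mul]
      refine le_indicator_apply (fun _ ↦ ?_) (fun hxK ↦ ?_)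
      · have := g_range m (mem_range_self (f := g m) x)
        refine mul_le_of_le_one_left (norm_nonneg _) ?_
        rw [Real.norm_of_nonneg this.1]
        exact this.2
      · have : g m x = 0 := by
          rw [← Function.notMem_support, g_supp]; contrapose hxK; exact vK m hxK
        simp [this]
    · filter_upwards with x
      by_cases hxs : x ∈ s
      · simp [hg _ x hxs, indicator_of_mem hxs f]
      · rw [indicator_of_notMem hxs f]
        apply tendsto_const_nhds.congr'
        obtain ⟨ε, εpos, hε⟩ : ∃ ε, 0 < ε ∧ x ∉ Metric.thickening ε s := by
          rw [← hs.isClosed.closure_eq, Metric.closure_eq_iInter_thickening s] at hxs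
          simpa using hxs
        filter_upwards [(tendsto_order.1 u_lim).2 _ εpos] with m hm
        have : g m x = 0 := by
          rw [← Function.notMem_support, g_supp]
          contrapose hε
          exact Metric.thickening_mono hm.le s hε
        simp [this]
  refine ge_of_tendsto' L fun m ↦ ?_
  have hsupp : tsupport (g m) ⊆ Metric.cthickening δ s :=
    closure_minimal (by rw [g_supp]; exact vK m) Metric.isClosed_cthickening
  exact h _ (g_diff m) (hK.of_isClosed_subset (isClosed_tsupport _) hsupp) (hsupp.trans hKU)
    fun x ↦ (g_range m (mem_range_self x)).1

/-- By inner regularity, a non-null negativity set would contain a compact set of positive measure,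
over which the integral of `f` would be negative. -/
theorem ae_nonneg_of_integral_contDiff_smul_nonneg {n : ℕ}
    {μ : Measure (EuclideanSpace ℝ (Fin n))} [IsLocallyFiniteMeasure μ]
    {f : EuclideanSpace ℝ (Fin n) → ℝ} (hm : Measurable f)
    (hf : LocallyIntegrable f μ) {U : Set (EuclideanSpace ℝ (Fin n))} (hU : IsOpen U)
    (h : ∀ φ : EuclideanSpace ℝ (Fin n) → ℝ, ContDiff ℝ ∞ φ → HasCompactSupport φ →
      tsupport φ ⊆ U → (∀ x, 0 ≤ φ x) → 0 ≤ ∫ x, φ x * f x ∂μ) :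
    ∀ᵐ x ∂μ, x ∈ U → 0 ≤ f x := by
  rw [ae_iff]
  have hN : {x | ¬ (x ∈ U → 0 ≤ f x)} = U ∩ {x | f x < 0} := by
    ext x; simp
  rw [hN]
  by_contra hne
  obtain ⟨K, hKN, hK, hpos⟩ :=
    (hU.measurableSet.inter (measurableSet_lt hm measurable_const)).exists_lt_isCompact
      (pos_iff_ne_zero.2 hne)
  have h1 := setIntegral_isCompact_nonneg_of_integral_contDiff_smul_nonneg hf hU h hK
    (hKN.trans inter_subset_left)
  have h2 : 0 < ∫ x in K, -f x ∂μ := by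
    rw [setIntegral_pos_iff_support_of_nonneg_ae]
    · convert hpos using 2
      apply inter_eq_right.2
      intro x hx
      have := (hKN hx).2
      simp only [mem_ofPred_eq] at this
      simp only [Function.mem_support]
      exact (neg_pos.2 this).ne'
    · exact ae_restrict_of_forall_mem hK.measurableSet fun x hx ↦ by
        have := (hKN hx).2
        simp only [mem_ofPred_eq] at this
        simp only [Pi.zero_apply]; linarith
    · exact (hf.integrableOn_isCompact hK).neg
  rw [integral_neg] at h2
  linarith

/-! ### Divergence and sublevel sets -/

theorem continuous_divergence {n : ℕ}
    {X : EuclideanSpace ℝ (Fin n) → EuclideanSpace ℝ (Fin n)} (hX : ContDiff ℝ 1 X) :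
    Continuous (divergence X) := by
  have h : Continuous (fderiv ℝ X) := hX.continuous_fderiv (by norm_num)
  unfold divergence
  fun_prop

theorem divergence_eq_zero_of_notMem_tsupport {n : ℕ}
    {X : EuclideanSpace ℝ (Fin n) → EuclideanSpace ℝ (Fin n)} {x : EuclideanSpace ℝ (Fin n)}
    (hx : x ∉ tsupport X) : divergence X x = 0 := by
  have : fderiv ℝ X x = 0 := by
    by_contra h
    exact hx (support_fderiv_subset ℝ h)
  simp [divergence, this]

theorem hasCompactSupport_divergence {n : ℕ}
    {X : EuclideanSpace ℝ (Fin n) → EuclideanSpace ℝ (Fin n)} (hX : HasCompactSupport X) :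
    HasCompactSupport (divergence X) :=
  HasCompactSupport.intro hX fun _ hx ↦ divergence_eq_zero_of_notMem_tsupport hx

theorem divergence_smul {n : ℕ} {φ : EuclideanSpace ℝ (Fin n) → ℝ}
    {X : EuclideanSpace ℝ (Fin n) → EuclideanSpace ℝ (Fin n)} {x : EuclideanSpace ℝ (Fin n)}
    (hφ : DifferentiableAt ℝ φ x) (hX : DifferentiableAt ℝ X x) :
    divergence (fun y ↦ φ y • X y) x = φ x * divergence X x + fderiv ℝ φ x (X x) := by
  have h : X x = ∑ i, X x i • EuclideanSpace.single i (1 : ℝ) := by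
    ext j; simp [Finset.sum_apply, Pi.single_apply]
  conv_rhs => rw [h]
  rw [map_sum]
  unfold divergence
  rw [fderiv_fun_smul hφ hX, Finset.mul_sum, ← Finset.sum_add_distrib]
  refine Finset.sum_congr rfl fun i _ ↦ ?_
  simp [mul_comm]

theorem integral_divergence_eq_zero {n : ℕ}
    {X : EuclideanSpace ℝ (Fin n) → EuclideanSpace ℝ (Fin n)} (hX : ContDiff ℝ 1 X)
    (hc : HasCompactSupport X) : ∫ x, divergence X x = 0 := by
  have hd : Differentiable ℝ X := hX.differentiable (by norm_num)
  have hcoord : ∀ i, ContDiff ℝ 1 fun x ↦ X x i := fun i ↦ by fun_prop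
  have hsupp : ∀ i, HasCompactSupport fun x ↦ X x i := fun i ↦
    hc.comp_left (g := fun v : EuclideanSpace ℝ (Fin n) ↦ v i) rfl
  have hfd : ∀ i x, (fderiv ℝ X x (EuclideanSpace.single i 1)) i
      = fderiv ℝ (fun x ↦ X x i) x (EuclideanSpace.single i 1) := by
    intro i x
    have := ((EuclideanSpace.proj (𝕜 := ℝ) i).hasFDerivAt.comp x (hd x).hasFDerivAt).fderiv
    change fderiv ℝ (fun x ↦ X x i) x = _ at this
    rw [this]; rfl
  have hint : ∀ i, Integrable fun x ↦ fderiv ℝ (fun x ↦ X x i) x (EuclideanSpace.single i 1) := by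
    intro i
    refine Continuous.integrable_of_hasCompactSupport ?_ ?_
    · have := (hcoord i).continuous_fderiv (by norm_num); fun_prop
    · exact (hsupp i).fderiv_apply ℝ _
  unfold divergence
  simp_rw [hfd]
  rw [integral_finsetSum _ fun i _ ↦ hint i]
  refine Finset.sum_eq_zero fun i _ ↦ ?_
  -- Integration by parts against the constant 1 kills each coordinate term.
  have := integral_mul_fderiv_eq_neg_fderiv_mul_of_integrable (μ := volume)
    (f := fun _ : EuclideanSpace ℝ (Fin n) ↦ (1 : ℝ)) (g := fun x ↦ X x i)
    (v := EuclideanSpace.single i 1) (by simp) (by simpa using hint i)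
    (by simpa using (hcoord i).continuous.integrable_of_hasCompactSupport (hsupp i))
    (fun x _ ↦ by fun_prop) (fun x _ ↦ (hcoord i).differentiable (by norm_num) x)
  simpa using this

/-- Integrals of a divergence over a sublevel set `{g < 0}`, when the field points towards
increasing `g`. -/
theorem setIntegral_divergence_nonneg {n : ℕ} {U O : Set (EuclideanSpace ℝ (Fin n))}
    (hU : MeasurableSet U) {g : EuclideanSpace ℝ (Fin n) → ℝ} (hg : ContDiff ℝ ∞ g)
    (hUg : ∀ y ∈ O, y ∈ U ↔ g y < 0)
    {X : EuclideanSpace ℝ (Fin n) → EuclideanSpace ℝ (Fin n)} (hX : ContDiff ℝ 1 X)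
    (hc : HasCompactSupport X) (hXO : tsupport X ⊆ O) (hpos : ∀ y, 0 ≤ fderiv ℝ g y (X y)) :
    0 ≤ ∫ x in U, divergence X x := by
  -- Smooth decreasing approximations of the indicator of `s < 0`, exactly 0 for `s ≥ 0`. The
  -- divergence of `h m (g) X` integrates to zero, and its extra term `h m'(g) dg(X)` is
  -- nonpositive, so the integral of `h m (g) div X` is nonnegative; then `m → ∞`.
  let h : ℕ → ℝ → ℝ := fun m s ↦ Real.smoothTransition (-(m * s))
  have hh : ∀ m, ContDiff ℝ ∞ (h m) := fun m ↦
    Real.smoothTransition.contDiff.comp (by fun_prop)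
  have hanti : ∀ m s, deriv (h m) s ≤ 0 := by
    intro m s
    have : Monotone fun s ↦ -h m s := fun a b hab ↦ by
      have : h m b ≤ h m a := Real.smoothTransition.monotone (by
        have : (m : ℝ) * a ≤ m * b := by gcongr
        linarith)
      simpa using this
    have := this.deriv_nonneg (x := s)
    rw [deriv.fun_neg] at this
    linarith
  have hhg : ∀ m, ContDiff ℝ ∞ fun y ↦ h m (g y) := fun m ↦ (hh m).comp hg
  have hXd : Differentiable ℝ X := hX.differentiable (by norm_num)
  have hdi : Integrable (divergence X) :=
    (continuous_divergence hX).integrable_of_hasCompactSupport (hasCompactSupport_divergence hc)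
  have key : ∀ m, 0 ≤ ∫ x, h m (g x) * divergence X x := by
    intro m
    have hXm : ContDiff ℝ 1 fun y ↦ h m (g y) • X y :=
      ((hhg m).of_le (by exact_mod_cast le_top)).smul hX
    have hcm : HasCompactSupport fun y ↦ h m (g y) • X y :=
      hc.smul_left (f := fun y ↦ h m (g y))
    have h0 := integral_divergence_eq_zero hXm hcm
    have h1 : ∀ x, divergence (fun y ↦ h m (g y) • X y) x
        = h m (g x) * divergence X x + deriv (h m) (g x) * fderiv ℝ g x (X x) := by
      intro x
      have e1 : DifferentiableAt ℝ (h m) (g x) := (hh m).differentiable (by simp) _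
      have e2 : DifferentiableAt ℝ g x := hg.differentiable (by simp) _
      rw [divergence_smul ((hhg m).differentiable (by simp) x) (hXd x)]
      have := (e1.hasDerivAt.comp_hasFDerivAt x e2.hasFDerivAt).fderiv
      change fderiv ℝ (fun y ↦ h m (g y)) x = _ at this
      rw [this]
      simp
    have h2 : ∀ x, divergence (fun y ↦ h m (g y) • X y) x ≤ h m (g x) * divergence X x := by
      intro x
      rw [h1]
      linarith [mul_nonpos_of_nonpos_of_nonneg (hanti m (g x)) (hpos x)]
    rw [← h0]
    refine integral_mono ?_ ?_ h2
    · exact (continuous_divergence hXm).integrable_of_hasCompactSupport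
        (hasCompactSupport_divergence hcm)
    · exact ((hhg m).continuous.mul (continuous_divergence hX)).integrable_of_hasCompactSupport
        (hasCompactSupport_divergence hc).mul_left
  have lim : Tendsto (fun m ↦ ∫ x, h m (g x) * divergence X x) atTop
      (𝓝 (∫ x in U, divergence X x)) := by
    rw [← integral_indicator hU]
    refine tendsto_integral_of_dominated_convergence (fun x ↦ ‖divergence X x‖)
      (fun m ↦ ((hhg m).continuous.mul (continuous_divergence hX)).aestronglyMeasurable)
      hdi.norm ?_ ?_
    · intro m
      filter_upwards with x
      rw [norm_mul]
      refine mul_le_of_le_one_left (norm_nonneg _) ?_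
      rw [Real.norm_of_nonneg (Real.smoothTransition.nonneg _)]
      exact Real.smoothTransition.le_one _
    · filter_upwards with x
      by_cases hx : x ∈ tsupport X
      · have hxU := hUg x (hXO hx)
        by_cases hgx : g x < 0
        · rw [indicator_of_mem (hxU.2 hgx)]
          apply tendsto_const_nhds.congr'
          obtain ⟨N, hN⟩ := exists_nat_gt (1 / (-g x))
          filter_upwards [eventually_ge_atTop N] with m hm
          have : h m (g x) = 1 := Real.smoothTransition.one_of_one_le (by
            rw [div_lt_iff₀ (by linarith)] at hN
            have : (N : ℝ) ≤ m := by exact_mod_cast hm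
            nlinarith)
          rw [this, one_mul]
        · rw [indicator_of_notMem (fun h ↦ hgx (hxU.1 h))]
          have : ∀ m, h m (g x) = 0 := fun m ↦ Real.smoothTransition.zero_of_nonpos (by
            have : (0 : ℝ) ≤ m * g x := mul_nonneg (Nat.cast_nonneg _) (not_lt.1 hgx)
            linarith)
          simp [this]
      · have h0 := divergence_eq_zero_of_notMem_tsupport hx
        have : U.indicator (divergence X) x = 0 := by
          by_cases hxU : x ∈ U <;> simp [hxU, h0]
        simp [h0, this]
  exact ge_of_tendsto' lim key

/-! ### The measure-theoretic normal of a regular sublevel set -/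

theorem inner_gradient {n : ℕ} (g : EuclideanSpace ℝ (Fin n) → ℝ)
    (x v : EuclideanSpace ℝ (Fin n)) : inner ℝ (gradient g x) v = fderiv ℝ g x v :=
  InnerProductSpace.toDual_symm_apply

theorem contDiff_gradient {n : ℕ} {g : EuclideanSpace ℝ (Fin n) → ℝ} (hg : ContDiff ℝ ∞ g) :
    ContDiff ℝ ∞ (gradient g) :=
  (InnerProductSpace.toDual ℝ (EuclideanSpace ℝ (Fin n))).symm.contDiff.comp
    (hg.fderiv_right (by simp))

/-- The fields `φ Y` with `φ ≥ 0` supported in `O` have nonnegative divergence integral over `U`;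
Gauss-Green turns this into a sign for `⟨Y, ν⟩` tested against every `φ`. -/
theorem IsGaussGreen.ae_inner_nonneg {n : ℕ} {U O : Set (EuclideanSpace ℝ (Fin n))}
    {τ : Measure (EuclideanSpace ℝ (Fin n))}
    {ν : EuclideanSpace ℝ (Fin n) → EuclideanSpace ℝ (Fin n)} (hGG : IsGaussGreen U τ ν)
    (hU : MeasurableSet U) (hO : IsOpen O) {g : EuclideanSpace ℝ (Fin n) → ℝ}
    (hg : ContDiff ℝ ∞ g) (hUg : ∀ y ∈ O, y ∈ U ↔ g y < 0)
    {Y : EuclideanSpace ℝ (Fin n) → EuclideanSpace ℝ (Fin n)} (hY : ContDiff ℝ ∞ Y)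
    (hpos : ∀ y, 0 ≤ fderiv ℝ g y (Y y)) : ∀ᵐ x ∂τ, x ∈ O → 0 ≤ inner ℝ (Y x) (ν x) := by
  have := hGG.locallyFinite
  have hm : Measurable fun x ↦ inner ℝ (Y x) (ν x) :=
    hY.continuous.measurable.inner hGG.measurable
  refine ae_nonneg_of_integral_contDiff_smul_nonneg hm ?_ hO ?_
  · refine hY.continuous.locallyIntegrable.mono hm.aestronglyMeasurable ?_
    filter_upwards [hGG.unit] with x hx
    simpa [hx] using norm_inner_le_norm (𝕜 := ℝ) (Y x) (ν x)
  · intro φ hφ hc hφO hφ0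
    have h1 : ContDiff ℝ 1 fun y ↦ φ y • Y y := (hφ.smul hY).of_le (by exact_mod_cast le_top)
    have hcs : HasCompactSupport fun y ↦ φ y • Y y := hc.smul_right
    have h2 := setIntegral_divergence_nonneg hU hg hUg h1 hcs
      ((tsupport_smul_subset_left φ Y).trans hφO) fun y ↦ by
        rw [map_smul]; exact mul_nonneg (hφ0 y) (hpos y)
    rw [hGG.gauss_green _ h1 hcs] at h2
    simpa only [real_inner_smul_left] using h2

/-- Inside a region where `U = {g < 0}`, the measure-theoretic normal is `∇g / |∇g|`. -/
theorem IsGaussGreen.ae_eq_normal {n : ℕ} {U O : Set (EuclideanSpace ℝ (Fin n))}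
    {τ : Measure (EuclideanSpace ℝ (Fin n))}
    {ν : EuclideanSpace ℝ (Fin n) → EuclideanSpace ℝ (Fin n)} (hGG : IsGaussGreen U τ ν)
    (hU : MeasurableSet U) (hO : IsOpen O) {g : EuclideanSpace ℝ (Fin n) → ℝ}
    (hg : ContDiff ℝ ∞ g) (hUg : ∀ y ∈ O, y ∈ U ↔ g y < 0) :
    ∀ᵐ x ∂τ, x ∈ O → gradient g x ≠ 0 → ν x = ‖gradient g x‖⁻¹ • gradient g x := by
  have hG := contDiff_gradient hg
  have hself : ∀ y, fderiv ℝ g y (gradient g y) = ‖gradient g y‖ ^ 2 := fun y ↦ by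
    rw [← inner_gradient, real_inner_self_eq_norm_sq]
  -- `|∇g|²` times the projection of the `i`-th basis vector onto the tangent space of the level
  -- set. The factor keeps the field smooth where `∇g` vanishes. Since `dg(T i) = 0`, both signs are
  -- allowed and `⟨T i, ν⟩ = 0`.
  let T : Fin n → EuclideanSpace ℝ (Fin n) → EuclideanSpace ℝ (Fin n) := fun i y ↦
    (‖gradient g y‖ ^ 2) • EuclideanSpace.single i 1
      - (inner ℝ (gradient g y) (EuclideanSpace.single i 1)) • gradient g y
  have hT : ∀ i, ContDiff ℝ ∞ (T i) := fun i ↦ by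
    refine ContDiff.sub (ContDiff.fun_smul ?_ contDiff_const)
      (ContDiff.fun_smul ?_ hG)
    · exact hG.norm_sq ℝ
    · exact hG.inner ℝ contDiff_const
  have hT0 : ∀ i y, fderiv ℝ g y (T i y) = 0 := fun i y ↦ by
    simp only [T, map_sub, map_smul, hself, ← inner_gradient g y (EuclideanSpace.single i 1),
      smul_eq_mul]
    ring
  have h1 := hGG.ae_inner_nonneg hU hO hg hUg hG fun y ↦ by rw [hself]; positivity
  have h2 : ∀ᵐ x ∂τ, ∀ i, x ∈ O → 0 ≤ inner ℝ (T i x) (ν x) := ae_all_iff.2 fun i ↦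
    hGG.ae_inner_nonneg hU hO hg hUg (hT i) fun y ↦ (hT0 i y).ge
  have h3 : ∀ᵐ x ∂τ, ∀ i, x ∈ O → 0 ≤ inner ℝ (-T i x) (ν x) := ae_all_iff.2 fun i ↦
    hGG.ae_inner_nonneg hU hO hg hUg (hT i).neg fun y ↦ by rw [map_neg, hT0, neg_zero]
  filter_upwards [hGG.unit, h1, h2, h3] with x hx1 hxG hxT hxT' hxO hne
  have hn : 0 < ‖gradient g x‖ := norm_pos_iff.2 hne
  have hvec : (‖gradient g x‖ ^ 2) • ν x = (inner ℝ (gradient g x) (ν x)) • gradient g x := by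
    ext i
    have e1 := hxT i hxO
    have e2 := hxT' i hxO
    rw [inner_neg_left] at e2
    have e3 : inner ℝ (T i x) (ν x) = 0 := by linarith
    simp only [T, inner_sub_left, real_inner_smul_left, EuclideanSpace.inner_single_left,
      EuclideanSpace.inner_single_right] at e3
    simp at e3 ⊢
    linarith
  have hnorm := congrArg norm hvec
  rw [norm_smul, norm_smul, hx1, Real.norm_of_nonneg (hxG hxO),
    Real.norm_of_nonneg (by positivity)] at hnorm
  have hin : inner ℝ (gradient g x) (ν x) = ‖gradient g x‖ := by
    apply mul_right_cancel₀ hn.ne'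
    linarith
  rw [hin] at hvec
  have := congrArg (fun v ↦ (‖gradient g x‖ ^ 2)⁻¹ • v) hvec
  simp only [smul_smul] at this
  rw [inv_mul_cancel₀ (by positivity), one_smul] at this
  rw [this]
  congr 1
  field_simp

theorem hasDerivAt_max_sq (s : ℝ) :
    HasDerivAt (fun s : ℝ ↦ (max 0 s) ^ 2) (2 * max 0 s) s := by
  rcases lt_trichotomy s 0 with hs | rfl | hs
  · rw [max_eq_left hs.le, mul_zero]
    refine (hasDerivAt_const s (0 : ℝ)).congr_of_eventuallyEq ?_
    filter_upwards [gt_mem_nhds hs] with t ht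
    simp [max_eq_left ht.le]
  · rw [max_self, mul_zero, hasDerivAt_iff_isLittleO]
    simp only [sub_zero, max_self, smul_zero, ne_eq, OfNat.ofNat_ne_zero, not_false_eq_true,
      zero_pow]
    refine Asymptotics.IsBigO.trans_isLittleO (g := fun t : ℝ ↦ t ^ 2) ?_ ?_
    · refine Asymptotics.IsBigO.of_bound 1 (Eventually.of_forall fun t ↦ ?_)
      rw [Real.norm_of_nonneg (sq_nonneg _), Real.norm_of_nonneg (sq_nonneg _), one_mul]
      rcases le_total 0 t with h | h
      · rw [max_eq_right h]
      · simpa [max_eq_left h] using sq_nonneg t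
    · exact Asymptotics.isLittleO_pow_id one_lt_two
  · rw [max_eq_right hs.le]
    have := hasDerivAt_pow 2 s
    simp only [Nat.cast_ofNat, Nat.add_one_sub_one, pow_one] at this
    refine this.congr_of_eventuallyEq ?_
    filter_upwards [lt_mem_nhds hs] with t ht
    simp [max_eq_right ht.le]

/-- Squaring removes the corner of the positive part; this is the profile of a `C¹` radial bump with
explicit gradient. -/
theorem contDiff_max_sq : ContDiff ℝ 1 (fun s : ℝ ↦ (max 0 s) ^ 2) := by
  rw [contDiff_one_iff_deriv]
  refine ⟨fun s ↦ (hasDerivAt_max_sq s).differentiableAt, ?_⟩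
  have : deriv (fun s : ℝ ↦ (max 0 s) ^ 2) = fun s ↦ 2 * max 0 s :=
    funext fun s ↦ (hasDerivAt_max_sq s).deriv
  rw [this]; fun_prop

/-! ### Regular boundary points are in the reduced boundary -/

theorem eventually_neg_of_fderiv_neg {n : ℕ} {g : EuclideanSpace ℝ (Fin n) → ℝ}
    {x v : EuclideanSpace ℝ (Fin n)} (hg : DifferentiableAt ℝ g x) (h0 : g x = 0)
    (hv : fderiv ℝ g x v < 0) : ∀ᶠ t in 𝓝[>] (0 : ℝ), g (x + t • v) < 0 := by
  have hl : HasDerivAt (fun t : ℝ ↦ x + t • v) v 0 := by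
    simpa using ((hasDerivAt_id (0 : ℝ)).smul_const v).const_add x
  have hx : x + (0 : ℝ) • v = x := by simp
  have hd : HasDerivAt (fun t : ℝ ↦ g (x + t • v)) (fderiv ℝ g x v) 0 := by
    have : HasFDerivAt g (fderiv ℝ g x) (x + (0 : ℝ) • v) := by rw [hx]; exact hg.hasFDerivAt
    exact this.comp_hasDerivAt 0 hl
  have := (hd.tendsto_slope.mono_left (nhdsWithin_mono (0 : ℝ)
    (fun t (ht : t ∈ Ioi (0 : ℝ)) ↦ (ne_of_gt ht)))).eventually (gt_mem_nhds hv)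
  filter_upwards [this, self_mem_nhdsWithin] with t ht ht0
  rw [slope_def_field, hx, h0, sub_zero, sub_zero, div_lt_iff₀ ht0, zero_mul] at ht
  exact ht

theorem eventually_add_smul_mem {n : ℕ} (x v : EuclideanSpace ℝ (Fin n))
    {O : Set (EuclideanSpace ℝ (Fin n))} (hO : O ∈ 𝓝 x) :
    ∀ᶠ t in 𝓝[>] (0 : ℝ), x + t • v ∈ O := by
  have : Tendsto (fun t : ℝ ↦ x + t • v) (𝓝 0) (𝓝 (x + (0 : ℝ) • v)) :=
    (continuous_const.add (continuous_id.smul continuous_const)).tendsto 0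
  rw [zero_smul, add_zero] at this
  exact (this.mono_left nhdsWithin_le_nhds) hO

/-- If the ball were null, every test field supported in it would have zero divergence integral over
`U`. A radial bump times the constant vector `G`, with centre pushed from `x` in the direction `G`,
violates this: in the ball, all of `U` lies behind the centre, where the bump increases along `G`.
-/
theorem IsGaussGreen.measure_ball_pos {n : ℕ} {U : Set (EuclideanSpace ℝ (Fin n))}
    {τ : Measure (EuclideanSpace ℝ (Fin n))}
    {ν : EuclideanSpace ℝ (Fin n) → EuclideanSpace ℝ (Fin n)} (hGG : IsGaussGreen U τ ν)
    {g : EuclideanSpace ℝ (Fin n) → ℝ}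
    (hg : ContDiff ℝ ∞ g) {x : EuclideanSpace ℝ (Fin n)} (hUg : ∀ᶠ y in 𝓝 x, y ∈ U ↔ g y < 0)
    (h0 : g x = 0) (hG : gradient g x ≠ 0) (hU : MeasurableSet U) {r : ℝ} (hr : 0 < r) :
    0 < τ (Metric.ball x r) := by
  have hgx : DifferentiableAt ℝ g x := hg.differentiable (by simp) x
  set G := gradient g x with hGdef
  have hGn : 0 < ‖G‖ := norm_pos_iff.2 hG
  by_contra hτ
  have hτ0 : τ (Metric.ball x r) = 0 := by simpa using hτ
  obtain ⟨r₁, hr₁, hB₁⟩ := Metric.eventually_nhds_iff_ball.1 hUg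
  have hlo : ∀ᶠ y in 𝓝 x, ‖g y - inner ℝ G (y - x)‖ ≤ ‖G‖ / 4 * ‖y - x‖ := by
    have := (hasFDerivAt_iff_isLittleO.1 hgx.hasFDerivAt).bound (c := ‖G‖ / 4) (by positivity)
    filter_upwards [this] with y hy
    rwa [h0, sub_zero, ← inner_gradient] at hy
  obtain ⟨r₂, hr₂, hB₂⟩ := Metric.eventually_nhds_iff_ball.1 hlo
  obtain ⟨ρ, hρ, hρr⟩ : ∃ ρ > 0, ρ < min r (min r₁ r₂) :=
    exists_between (lt_min hr (lt_min hr₁ hr₂))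
  have hρ0 := lt_of_lt_of_le hρr (min_le_left _ _)
  have hρ1 := lt_of_lt_of_le hρr ((min_le_right _ _).trans (min_le_left _ _))
  have hρ2 := lt_of_lt_of_le hρr ((min_le_right _ _).trans (min_le_right _ _))
  -- With `|a - x| = R / 2`, the support stays within `3R/2 < ρ` of `x`. The linearization error
  -- there is at most `3/8 R |G|`, less than the offset `R/2 |G|` of the centre.
  set R := ρ / 2 with hR
  have hRpos : 0 < R := by positivity
  set a := x + (R / (2 * ‖G‖)) • G with ha
  have hax : ‖a - x‖ = R / 2 := by
    rw [ha, add_sub_cancel_left, norm_smul, Real.norm_of_nonneg (by positivity)]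
    field_simp
  let φ : EuclideanSpace ℝ (Fin n) → ℝ := fun y ↦ (max 0 (R ^ 2 - ‖y - a‖ ^ 2)) ^ 2
  have hφ : ContDiff ℝ 1 φ :=
    contDiff_max_sq.comp (contDiff_const.sub ((contDiff_id.sub contDiff_const).norm_sq ℝ))
  have hclosed : ∀ y ∈ Metric.closedBall a R, ‖y - x‖ ≤ 3 / 2 * R := by
    intro y hy
    rw [mem_closedBall_iff_norm] at hy
    have := norm_add_le (y - a) (a - x)
    rw [sub_add_sub_cancel, hax] at this
    linarith
  have hsupp : tsupport φ ⊆ Metric.closedBall a R := by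
    refine closure_minimal (fun y hy ↦ ?_) Metric.isClosed_closedBall
    rw [mem_closedBall_iff_norm]
    by_contra hlt
    push Not at hlt
    refine hy ?_
    have : R ^ 2 - ‖y - a‖ ^ 2 ≤ 0 := by nlinarith
    simp [φ, max_eq_left this]
  have hφc : HasCompactSupport φ :=
    (isCompact_closedBall a R).of_isClosed_subset (isClosed_tsupport _) hsupp
  have hX : ContDiff ℝ 1 fun y ↦ φ y • G := hφ.smul contDiff_const
  have hXc : HasCompactSupport fun y ↦ φ y • G := hφc.smul_right (f' := fun _ ↦ G)
  have hdiv : ∀ y, divergence (fun y ↦ φ y • G) y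
      = 4 * max 0 (R ^ 2 - ‖y - a‖ ^ 2) * -(inner ℝ (y - a) G) := by
    intro y
    rw [divergence_smul (hφ.differentiable (by norm_num) y) (differentiableAt_const G)]
    have hc : divergence (fun _ : EuclideanSpace ℝ (Fin n) ↦ G) y = 0 := by simp [divergence]
    have h1 : HasFDerivAt (fun y ↦ R ^ 2 - ‖y - a‖ ^ 2) (-(2 • innerSL ℝ (y - a))) y := by
      have := (((hasFDerivAt_id y).sub_const a).norm_sq).const_sub (R ^ 2)
      simpa using this
    have h2 := ((hasDerivAt_max_sq _).comp_hasFDerivAt y h1).fderiv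
    change fderiv ℝ φ y = _ at h2
    rw [hc, h2]
    simp [inner_sub_left]
    ring
  have hneg : ∀ y ∈ U, y ∈ Metric.ball a R → inner ℝ (y - a) G < 0 := by
    intro y hyU hy
    have hyx := hclosed y (Metric.ball_subset_closedBall hy)
    have hy1 : y ∈ Metric.ball x r₁ := mem_ball_iff_norm.2 (by linarith)
    have hy2 : y ∈ Metric.ball x r₂ := mem_ball_iff_norm.2 (by linarith)
    have hgy := (hB₁ y hy1).1 hyU
    have hlo := (abs_le.1 (hB₂ y hy2)).1
    have hsplit : inner ℝ (y - a) G = inner ℝ G (y - x) - R / 2 * ‖G‖ := by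
      have : y - a = (y - x) - (R / (2 * ‖G‖)) • G := by rw [ha]; module
      rw [this, inner_sub_left, real_inner_smul_left, real_inner_self_eq_norm_sq,
        real_inner_comm]
      field_simp
    rw [hsplit]
    have : ‖G‖ / 4 * ‖y - x‖ ≤ ‖G‖ / 4 * (3 / 2 * R) := by gcongr
    nlinarith [mul_pos hGn hRpos]
  have hzero : ∫ y in U, divergence (fun y ↦ φ y • G) y = 0 := by
    rw [hGG.gauss_green _ hX hXc]
    refine integral_eq_zero_of_ae ?_
    have : ∀ᵐ y ∂τ, y ∉ Metric.ball x r := measure_eq_zero_iff_ae_notMem.1 hτ0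
    filter_upwards [this] with y hy
    have : φ y = 0 := by
      by_contra hne
      refine hy (mem_ball_iff_norm.2 ?_)
      have := hclosed y (hsupp (subset_tsupport _ hne))
      linarith
    simp [this]
  have hpos : 0 < ∫ y in U, divergence (fun y ↦ φ y • G) y := by
    have hnn : ∀ y ∈ U, 0 ≤ divergence (fun y ↦ φ y • G) y := by
      intro y hy
      rw [hdiv]
      by_cases hyB : y ∈ Metric.ball a R
      · exact mul_nonneg (by positivity) (neg_nonneg.2 (hneg y hy hyB).le)
      · rw [mem_ball_iff_norm, not_lt] at hyB
        rw [max_eq_left (by nlinarith)]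
        simp
    rw [setIntegral_pos_iff_support_of_nonneg_ae (ae_restrict_of_forall_mem hU hnn)
      ((continuous_divergence hX).integrable_of_hasCompactSupport
        (hasCompactSupport_divergence hXc)).integrableOn]
    have hxa : x ∈ Metric.ball a R := by
      rw [mem_ball_iff_norm, norm_sub_rev, hax]; linarith
    -- A small step from `x` along `-G` shows that the open set where the divergence is positive is
    -- non-empty.
    obtain ⟨t, htg, htB⟩ := ((eventually_neg_of_fderiv_neg (v := -G) hgx h0 (by
      rw [map_neg, ← inner_gradient, real_inner_self_eq_norm_sq]
      have : 0 < ‖G‖ ^ 2 := by positivity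
      linarith)).and
        (eventually_add_smul_mem x (-G) (Metric.isOpen_ball.mem_nhds hxa))).exists
    have hopen : IsOpen (Metric.ball a R ∩ {y | g y < 0}) :=
      Metric.isOpen_ball.inter (isOpen_lt hg.continuous continuous_const)
    refine lt_of_lt_of_le (hopen.measure_pos volume ⟨_, htB, htg⟩) (measure_mono ?_)
    rintro y ⟨hyB, hyg⟩
    have hyx := hclosed y (Metric.ball_subset_closedBall hyB)
    have hyU : y ∈ U := (hB₁ y (mem_ball_iff_norm.2 (by linarith))).2 hyg
    refine ⟨?_, hyU⟩
    rw [Function.mem_support, hdiv]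
    rw [mem_ball_iff_norm] at hyB
    have h1 : 0 < R ^ 2 - ‖y - a‖ ^ 2 := by nlinarith [norm_nonneg (y - a)]
    have h2 := hneg y hyU (mem_ball_iff_norm.2 hyB)
    rw [max_eq_right h1.le]
    have : 0 < 4 * (R ^ 2 - ‖y - a‖ ^ 2) * -(inner ℝ (y - a) G) :=
      mul_pos (by positivity) (neg_pos.2 h2)
    exact this.ne'
  exact hpos.ne' hzero

/-- A point near which `U` is the regular sublevel set `{g < 0}`, and at which `g` vanishes, is
in the reduced boundary of `U`. -/
theorem IsGaussGreen.mem_reducedBoundaryEuclidean {n : ℕ} {U : Set (EuclideanSpace ℝ (Fin n))}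
    {τ : Measure (EuclideanSpace ℝ (Fin n))}
    {ν : EuclideanSpace ℝ (Fin n) → EuclideanSpace ℝ (Fin n)} (hGG : IsGaussGreen U τ ν)
    {g : EuclideanSpace ℝ (Fin n) → ℝ}
    (hg : ContDiff ℝ ∞ g) {x : EuclideanSpace ℝ (Fin n)} (hUg : ∀ᶠ y in 𝓝 x, y ∈ U ↔ g y < 0)
    (h0 : g x = 0) (hG : gradient g x ≠ 0) (hU : MeasurableSet U) :
    x ∈ reducedBoundaryEuclidean U := by
  have := hGG.locallyFinite
  have hballs : ∀ r > 0, 0 < τ (Metric.ball x r) := fun r hr ↦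
    hGG.measure_ball_pos hg hUg h0 hG hU hr
  have hcont : Continuous (gradient g) := (contDiff_gradient hg).continuous
  refine ⟨τ, ν, hGG, hballs, ‖gradient g x‖⁻¹ • gradient g x, norm_smul_inv_norm hG, ?_⟩
  rw [Metric.tendsto_nhds]
  intro ε hε
  have hN : ContinuousAt (fun y ↦ ‖gradient g y‖⁻¹ • gradient g y) x :=
    (hcont.norm.continuousAt.inv₀ (norm_ne_zero_iff.2 hG)).smul hcont.continuousAt
  have hev : ∀ᶠ y in 𝓝 x, (y ∈ U ↔ g y < 0) ∧ gradient g y ≠ 0 ∧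
      dist (‖gradient g y‖⁻¹ • gradient g y) (‖gradient g x‖⁻¹ • gradient g x) < ε / 2 :=
    hUg.and ((hcont.continuousAt.eventually_ne hG).and
      (Metric.tendsto_nhds.1 hN _ (half_pos hε)))
  obtain ⟨r, hr, hB⟩ := Metric.eventually_nhds_iff_ball.1 hev
  have hae := hGG.ae_eq_normal hU Metric.isOpen_ball hg fun y hy ↦ (hB y hy).1
  filter_upwards [Ioo_mem_nhdsGT hr] with s hs
  have hfin : τ (Metric.ball x s) < ⊤ :=
    (measure_mono Metric.ball_subset_closedBall).trans_lt (isCompact_closedBall x s).measure_lt_top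
  have hint : IntegrableOn ν (Metric.ball x s) τ :=
    Measure.integrableOn_of_bounded hfin.ne hGG.measurable.aestronglyMeasurable
      (M := 1) (ae_restrict_of_ae (hGG.unit.mono fun y hy ↦ hy.le))
  -- Almost every normal near `x` lies in this closed convex ball, hence so does the average.
  have := (convex_closedBall (‖gradient g x‖⁻¹ • gradient g x) (ε / 2)).set_average_mem
    Metric.isClosed_closedBall (hballs s hs.1).ne' hfin.ne (by
      rw [ae_restrict_iff' measurableSet_ball]
      filter_upwards [hae] with y hy hys
      have hyr := Metric.ball_subset_ball hs.2.le hys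
      rw [hy hyr (hB y hyr).2.1]
      exact (hB y hyr).2.2.le) hint
  exact lt_of_le_of_lt this (half_lt_self hε)

/-! ### Affine functions on the hyperboloid, in the chart -/

/-- The function `y ↦ ⟨c, y⟩₁ - κ` on `ℍⁿ`, read in the graph chart. -/
def chartFun {n : ℕ} (c : Vec n) (κ : ℝ) (x : EuclideanSpace ℝ (Fin n)) : ℝ :=
  inner ℝ (space c) x - c 0 * Real.sqrt (1 + ‖x‖ ^ 2) - κ

theorem mink_ofChart {n : ℕ} (c : Vec n) (κ : ℝ) (x : EuclideanSpace ℝ (Fin n)) :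
    mink c (ofChart x).val - κ = chartFun c κ x := by
  simp [mink, chartFun, ofChart]

theorem space_ofChart {n : ℕ} (x : EuclideanSpace ℝ (Fin n)) : space (ofChart x).val = x := by
  simp [ofChart]

theorem space_sub {n : ℕ} (c d : Vec n) : space (c - d) = space c - space d := rfl

theorem chartFun_sub {n : ℕ} (c d : Vec n) (κ l : ℝ) (x : EuclideanSpace ℝ (Fin n)) :
    chartFun (c - d) (κ - l) x = chartFun c κ x - chartFun d l x := by
  simp only [chartFun, space_sub, inner_sub_left, PiLp.sub_apply]; ring

theorem chartFun_smul {n : ℕ} (a : ℝ) (c : Vec n) (κ : ℝ) (x : EuclideanSpace ℝ (Fin n)) :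
    chartFun (a • c) (a * κ) x = a * chartFun c κ x := by
  simp only [chartFun, space_smul, real_inner_smul_left, PiLp.smul_apply, smul_eq_mul]; ring

theorem contDiff_chartFun {n : ℕ} (c : Vec n) (κ : ℝ) : ContDiff ℝ ∞ (chartFun c κ) := by
  have h : ContDiff ℝ ∞ fun x : EuclideanSpace ℝ (Fin n) ↦ Real.sqrt (1 + ‖x‖ ^ 2) :=
    (contDiff_const.add (contDiff_id.norm_sq ℝ)).sqrt fun x ↦ by
      have : 0 < 1 + ‖id x‖ ^ 2 := by positivity
      exact this.ne'
  exact ((contDiff_const.inner ℝ contDiff_id).sub (contDiff_const.mul h)).sub contDiff_const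

theorem gradient_chartFun {n : ℕ} (c : Vec n) (κ : ℝ) (x : EuclideanSpace ℝ (Fin n)) :
    gradient (chartFun c κ) x = space c - (c 0 / Real.sqrt (1 + ‖x‖ ^ 2)) • x := by
  refine HasGradientAt.gradient ?_
  rw [hasGradientAt_iff_hasFDerivAt]
  have hpos : 0 < 1 + ‖x‖ ^ 2 := by positivity
  have h1 : HasFDerivAt (fun x : EuclideanSpace ℝ (Fin n) ↦ 1 + ‖x‖ ^ 2) (2 • innerSL ℝ x) x := by
    have := ((hasFDerivAt_id x).norm_sq).const_add 1
    simpa using this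
  have h2 := (h1.sqrt hpos.ne').const_mul (c 0)
  have h3 : HasFDerivAt (fun x ↦ inner ℝ (space c) x) (innerSL ℝ (space c)) x :=
    (innerSL ℝ (space c)).hasFDerivAt
  have h4 := (h3.sub h2).sub_const κ
  refine h4.congr_fderiv ?_
  ext v
  simp
  field_simp

/-- Criticality makes `c` proportional to the point of the hyperboloid over `x`, and the zero value
then fixes `κ`. So value and gradient at `x` determine such a function up to a multiple of `cosh
d(x, ·) - 1`. -/
theorem chartFun_of_gradient_eq_zero {n : ℕ} {c : Vec n} {κ : ℝ} {x : EuclideanSpace ℝ (Fin n)}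
    (h0 : chartFun c κ x = 0) (hG : gradient (chartFun c κ) x = 0)
    (y : EuclideanSpace ℝ (Fin n)) :
    chartFun c κ y = -(c 0 / Real.sqrt (1 + ‖x‖ ^ 2)) *
      (-mink (ofChart x).val (ofChart y).val - 1) := by
  have hpos : 0 < Real.sqrt (1 + ‖x‖ ^ 2) := by positivity
  rw [gradient_chartFun, sub_eq_zero] at hG
  have hm := mink_ofChart (ofChart x).val 0 y
  rw [sub_zero] at hm
  have hsq : Real.sqrt (1 + ‖x‖ ^ 2) ^ 2 = 1 + ‖x‖ ^ 2 := Real.sq_sqrt (by positivity)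
  have ht : (ofChart x).val 0 = Real.sqrt (1 + ‖x‖ ^ 2) := by simp [ofChart]
  rw [hm]
  unfold chartFun at h0 ⊢
  rw [hG, real_inner_smul_left] at h0 ⊢
  rw [space_ofChart, ht]
  rw [real_inner_self_eq_norm_sq] at h0
  set s := Real.sqrt (1 + ‖x‖ ^ 2)
  have hκ : κ = -(c 0 / s) := by
    have : ‖x‖ ^ 2 = s ^ 2 - 1 := by linarith
    rw [this] at h0
    field_simp at h0 ⊢
    linarith
  rw [hκ]
  field_simp
  ring

theorem neg_mink_ofChart_nonneg {n : ℕ} (x y : EuclideanSpace ℝ (Fin n)) :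
    0 ≤ -mink (ofChart x).val (ofChart y).val - 1 := by
  linarith [one_le_neg_mink (ofChart x) (ofChart y)]

theorem neg_mink_ofChart_pos {n : ℕ} {x y : EuclideanSpace ℝ (Fin n)} (h : y ≠ x) :
    0 < -mink (ofChart x).val (ofChart y).val - 1 := by
  refine lt_of_le_of_ne (neg_mink_ofChart_nonneg x y) fun h0 ↦ h ?_
  have hd : dist (ofChart x) (ofChart y) = 0 := by
    change Real.arcosh _ = 0
    rw [Real.arcosh_eq_zero_iff (one_le_neg_mink _ _)]
    linarith
  have := dist_eq_zero.1 hd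
  rw [← space_ofChart x, ← space_ofChart y, this]

/-- Test with the component of `a` orthogonal to `m`. It lies on the boundary of the open
half-space, so it is first tilted by `-ε m`, and `ε → 0` shows that it vanishes. -/
theorem eq_smul_of_inner_nonpos {E : Type*} [NormedAddCommGroup E] [InnerProductSpace ℝ E]
    {a m : E} (hm : m ≠ 0) (h : ∀ v, inner ℝ m v < 0 → inner ℝ a v ≤ 0) :
    ∃ μ : ℝ, 0 ≤ μ ∧ a = μ • m := by
  have hmm : 0 < ‖m‖ ^ 2 := by have := norm_pos_iff.2 hm; positivity
  set μ := inner ℝ a m / ‖m‖ ^ 2 with hμ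
  have hb : inner ℝ m (a - μ • m) = 0 := by
    rw [inner_sub_right, real_inner_smul_right, real_inner_self_eq_norm_sq, real_inner_comm, hμ]
    field_simp
    ring
  refine ⟨μ, ?_, ?_⟩
  · have := h (-m) (by rw [inner_neg_right, real_inner_self_eq_norm_sq]; linarith)
    rw [inner_neg_right] at this
    exact div_nonneg (by linarith) hmm.le
  · have key : ∀ ε : ℝ, 0 < ε → ‖a - μ • m‖ ^ 2 ≤ ε * (μ * ‖m‖ ^ 2) := by
      intro ε hε
      have h1 := h (a - μ • m - ε • m) (by
        rw [inner_sub_right, hb, real_inner_smul_right, real_inner_self_eq_norm_sq]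
        linarith [mul_pos hε hmm])
      have h2 : inner ℝ a (a - μ • m) = ‖a - μ • m‖ ^ 2 := by
        rw [← real_inner_self_eq_norm_sq, inner_sub_left (a), real_inner_smul_left, hb]; ring
      rw [inner_sub_right, h2, real_inner_smul_right] at h1
      have h3 : inner ℝ a m = μ * ‖m‖ ^ 2 := by rw [hμ]; field_simp
      rw [h3] at h1
      linarith
    have h0 : ‖a - μ • m‖ ^ 2 ≤ 0 := by
      have hlim : Tendsto (fun ε : ℝ ↦ ε * (μ * ‖m‖ ^ 2)) (𝓝[>] 0) (𝓝 0) := by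
        have : Tendsto (fun ε : ℝ ↦ ε * (μ * ‖m‖ ^ 2)) (𝓝 0) (𝓝 (0 * (μ * ‖m‖ ^ 2))) :=
          tendsto_id.mul_const _
        rw [zero_mul] at this
        exact this.mono_left nhdsWithin_le_nhds
      exact ge_of_tendsto hlim (by filter_upwards [self_mem_nhdsWithin] with ε hε using key ε hε)
    have := pow_eq_zero_iff two_ne_zero |>.1 (le_antisymm h0 (sq_nonneg _))
    exact sub_eq_zero.1 (norm_eq_zero.1 this)

/-! ### Regular boundary points of Voronoi cells -/

/-- For `n ≥ 2` a small sphere around `x` is connected, and `g` has opposite signs at its two points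
in the directions `±∇g`. -/
theorem exists_ne_mem_zero {n : ℕ} (hn : 2 ≤ n) {g : EuclideanSpace ℝ (Fin n) → ℝ}
    (hg : Differentiable ℝ g) {x : EuclideanSpace ℝ (Fin n)} (h0 : g x = 0)
    (hG : gradient g x ≠ 0) {O : Set (EuclideanSpace ℝ (Fin n))} (hO : O ∈ 𝓝 x) :
    ∃ y ∈ O, y ≠ x ∧ g y = 0 := by
  set G := gradient g x with hGdef
  have hGpos : 0 < ‖G‖ := norm_pos_iff.2 hG
  have hGG : fderiv ℝ g x G = ‖G‖ ^ 2 := by rw [← inner_gradient, real_inner_self_eq_norm_sq]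
  obtain ⟨r, hr, hB⟩ := Metric.mem_nhds_iff.1 hO
  have h1 := eventually_neg_of_fderiv_neg (v := -G) (hg x) h0 (by
    rw [map_neg, hGG]; exact neg_lt_zero.2 (by positivity))
  have h2 := eventually_neg_of_fderiv_neg (g := fun y ↦ -g y) (v := G) (hg x).neg
    (by rw [h0, neg_zero]) (by
      rw [fderiv_fun_neg, neg_apply, hGG]; exact neg_lt_zero.2 (by positivity))
  have h3 := eventually_add_smul_mem x G (Metric.ball_mem_nhds x hr)
  obtain ⟨t, ht1, ht2, ht3, ht0⟩ := (h1.and (h2.and (h3.and self_mem_nhdsWithin))).exists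
  replace ht0 : 0 < t := ht0
  rw [mem_ball_iff_norm, add_sub_cancel_left, norm_smul, Real.norm_of_nonneg ht0.le] at ht3
  have hconn : IsPreconnected (Metric.sphere x (t * ‖G‖)) := by
    refine isPreconnected_sphere ?_ _ _
    rw [← Module.finrank_eq_rank, finrank_euclideanSpace_fin]
    exact_mod_cast hn
  have hm1 : x + t • -G ∈ Metric.sphere x (t * ‖G‖) := by
    rw [mem_sphere_iff_norm, add_sub_cancel_left, norm_smul, norm_neg, Real.norm_of_nonneg ht0.le]
  have hm2 : x + t • G ∈ Metric.sphere x (t * ‖G‖) := by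
    rw [mem_sphere_iff_norm, add_sub_cancel_left, norm_smul, Real.norm_of_nonneg ht0.le]
  obtain ⟨y, hy, hy0⟩ := hconn.intermediate_value hm1 hm2 hg.continuous.continuousOn
    ⟨ht1.le, by linarith⟩
  refine ⟨y, hB ?_, ?_, hy0⟩
  · rw [mem_sphere_iff_norm] at hy
    rw [mem_ball_iff_norm, hy]; exact ht3
  · rintro rfl
    rw [mem_sphere_iff_norm, sub_self, norm_zero] at hy
    have : 0 < t * ‖G‖ := by positivity
    linarith

/-- Strict minimality regions, in the chart. -/
def chartCell {n : ℕ} {ι : Type*} (c : ι → Vec n) (κ : ι → ℝ) (i : ι) :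
    Set (EuclideanSpace ℝ (Fin n)) :=
  {x | ∀ j, j ≠ i → chartFun (c i) (κ i) x < chartFun (c j) (κ j) x}

theorem isOpen_chartCell {n : ℕ} {ι : Type*} [Finite ι] (c : ι → Vec n) (κ : ι → ℝ) (i : ι) :
    IsOpen (chartCell c κ i) := by
  unfold chartCell
  simp only [ofPred_forall]
  exact isOpen_iInter_of_finite fun j ↦ isOpen_iInter_of_finite fun _ ↦
    isOpen_lt (contDiff_chartFun _ _).continuous (contDiff_chartFun _ _).continuous

theorem gradient_chartFun_sub {n : ℕ} (c d : Vec n) (κ l : ℝ) (x : EuclideanSpace ℝ (Fin n)) :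
    gradient (chartFun (c - d) (κ - l)) x
      = gradient (chartFun c κ) x - gradient (chartFun d l) x := by
  simp only [gradient_chartFun, space_sub, PiLp.sub_apply]; module

theorem gradient_chartFun_smul {n : ℕ} (a : ℝ) (c : Vec n) (κ : ℝ)
    (x : EuclideanSpace ℝ (Fin n)) :
    gradient (chartFun (a • c) (a * κ)) x = a • gradient (chartFun c κ) x := by
  simp only [gradient_chartFun, space_smul, PiLp.smul_apply, smul_eq_mul]; module

/-- Differences of two functions with non-empty strict minimality regions are regular. -/
theorem gradient_ne_zero_of_nonempty {n : ℕ} {ι : Type*} {c : ι → Vec n} {κ : ι → ℝ}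
    (hne : ∀ i, (chartCell c κ i).Nonempty) {i j : ι} (hij : i ≠ j)
    {x : EuclideanSpace ℝ (Fin n)} (h0 : chartFun (c i - c j) (κ i - κ j) x = 0) :
    gradient (chartFun (c i - c j) (κ i - κ j)) x ≠ 0 := by
  intro hG
  -- A critical zero would give the difference a constant weak sign, but it is negative on cell `i`
  -- and positive on cell `j`.
  have h := chartFun_of_gradient_eq_zero h0 hG
  obtain ⟨y, hy⟩ := hne i
  obtain ⟨z, hz⟩ := hne j
  have h1 := h y
  have h2 := h z
  rw [chartFun_sub] at h1 h2
  have h3 := hy j hij.symm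
  have h4 := hz i hij
  have h5 := neg_mink_ofChart_nonneg x y
  have h6 := neg_mink_ofChart_nonneg x z
  rcases le_total 0 ((c i - c j) 0 / Real.sqrt (1 + ‖x‖ ^ 2)) with h7 | h7 <;> nlinarith

/-- Every cell has a regular boundary point at which exactly one other cell meets it. -/
theorem exists_regular_boundary_point {n : ℕ} (hn : 2 ≤ n) {ι : Type*} [Finite ι]
    {c : ι → Vec n} {κ : ι → ℝ} (hne : ∀ i, (chartCell c κ i).Nonempty) {k i : ι} (hik : i ≠ k) :
    ∃ j, j ≠ k ∧ ∃ x, chartFun (c k) (κ k) x = chartFun (c j) (κ j) x ∧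
      (∀ l, l ≠ k → l ≠ j → chartFun (c k) (κ k) x < chartFun (c l) (κ l) x) := by
  classical
  have := Fintype.ofFinite ι
  have hcont : ∀ j, Continuous (chartFun (c j) (κ j)) := fun j ↦ (contDiff_chartFun _ _).continuous
  obtain ⟨p, hp⟩ := hne k
  obtain ⟨z, hz⟩ := hne i
  have hzk : z ∈ (chartCell c κ k)ᶜ := fun h ↦ lt_asymm (h i hik) (hz k hik.symm)
  -- At a nearest point of the complement to `p`, the cell contains an open ball touching `x`. This
  -- forces the gradients of all differences active at `x` to be positive multiples of `m = x - p`.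
  obtain ⟨x, hxk, hxd⟩ := (isOpen_chartCell c κ k).isClosed_compl.exists_infDist_eq_dist ⟨z, hzk⟩ p
  have hball : ∀ y, dist p y < dist p x → y ∈ chartCell c κ k := by
    intro y hy
    by_contra hyk
    have := Metric.infDist_le_dist_of_mem (x := p) (s := (chartCell c κ k)ᶜ) hyk
    linarith
  have hpx : p ≠ x := fun h ↦ hxk (h ▸ hp)
  set m := x - p with hm
  have hm0 : m ≠ 0 := sub_ne_zero.2 hpx.symm
  have hin : ∀ v, inner ℝ m v < 0 → ∀ᶠ t in 𝓝[>] (0 : ℝ), x + t • v ∈ chartCell c κ k := by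
    intro v hv
    have hd : HasFDerivAt (fun y ↦ ‖y - p‖ ^ 2 - ‖x - p‖ ^ 2) (2 • innerSL ℝ (x - p)) x := by
      simpa using (((hasFDerivAt_id x).sub_const p).norm_sq).sub_const (‖x - p‖ ^ 2)
    have h1 := eventually_neg_of_fderiv_neg (v := v) hd.differentiableAt (by simp) (by
        rw [hd.fderiv]
        simp only [smul_apply, innerSL_apply_apply, nsmul_eq_mul]
        rw [← hm]
        push_cast
        linarith)
    filter_upwards [h1] with t ht
    refine hball _ ?_
    rw [dist_comm p, dist_comm p, dist_eq_norm, dist_eq_norm]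
    exact lt_of_pow_lt_pow_left₀ 2 (norm_nonneg _) (by linarith)
  have hle : ∀ j, chartFun (c k) (κ k) x ≤ chartFun (c j) (κ j) x := by
    intro j
    rcases eq_or_ne j k with rfl | hjk
    · exact le_rfl
    have h1 := hin (-m) (by
      rw [inner_neg_right, real_inner_self_eq_norm_sq]
      have := norm_pos_iff.2 hm0
      exact neg_lt_zero.2 (by positivity))
    have ht : Tendsto (fun t : ℝ ↦ x + t • -m) (𝓝[>] 0) (𝓝 x) := fun O hO ↦
      eventually_add_smul_mem x (-m) hO
    refine le_of_tendsto_of_tendsto (((hcont k).tendsto x).comp ht) (((hcont j).tendsto x).comp ht)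
      ?_
    filter_upwards [h1] with t h using (h j hjk).le
  let A : Finset ι := Finset.univ.filter fun j ↦
    j ≠ k ∧ chartFun (c k) (κ k) x = chartFun (c j) (κ j) x
  have hA : ∀ j, j ∈ A ↔ j ≠ k ∧ chartFun (c k) (κ k) x = chartFun (c j) (κ j) x := by
    intro j; simp [A]
  have hAne : A.Nonempty := by
    by_contra hA0
    refine hxk fun j hj ↦ lt_of_le_of_ne (hle j) fun h ↦ hA0 ⟨j, (hA j).2 ⟨hj, h⟩⟩
  have hg0 : ∀ j ∈ A, chartFun (c k - c j) (κ k - κ j) x = 0 := fun j hj ↦ by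
    rw [chartFun_sub, ((hA j).1 hj).2, sub_self]
  have hμ : ∀ j ∈ A, ∃ μ : ℝ, 0 < μ ∧ gradient (chartFun (c k - c j) (κ k - κ j)) x = μ • m := by
    intro j hj
    have hreg := gradient_ne_zero_of_nonempty hne ((hA j).1 hj).1.symm (hg0 j hj)
    obtain ⟨μ, hμ0, hμ⟩ := eq_smul_of_inner_nonpos
      (a := gradient (chartFun (c k - c j) (κ k - κ j)) x) hm0 fun v hv ↦ by
        by_contra hpos
        push Not at hpos
        rw [inner_gradient] at hpos
        have h1 := eventually_neg_of_fderiv_neg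
          (g := fun y ↦ -chartFun (c k - c j) (κ k - κ j) y) (x := x) (v := v)
          (((contDiff_chartFun _ _).differentiable (by simp)) x).neg
          (by rw [hg0 j hj, neg_zero])
          (by rw [fderiv_fun_neg, neg_apply]; linarith)
        obtain ⟨t, ht1, ht2⟩ := (h1.and (hin v hv)).exists
        have := ht2 j ((hA j).1 hj).1
        rw [chartFun_sub] at ht1
        linarith
    refine ⟨μ, lt_of_le_of_ne hμ0 ?_, hμ⟩
    rintro rfl
    exact hreg (by rw [hμ, zero_smul])
  choose! μ hμpos hμgrad using hμ
  obtain ⟨j₀, hj₀⟩ := hAne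
  set D : EuclideanSpace ℝ (Fin n) → ℝ := fun y ↦ -mink (ofChart x).val (ofChart y).val - 1 with hD
  set h : EuclideanSpace ℝ (Fin n) → ℝ := fun y ↦
    (μ j₀)⁻¹ * chartFun (c k - c j₀) (κ k - κ j₀) y with hh
  -- After division by `μ j`, all active differences have the same value and gradient at `x`, so
  -- they differ only by multiples of `D = cosh d(x, ·) - 1`.
  have hβ : ∀ j ∈ A, ∃ β : ℝ, ∀ y,
      chartFun (c k) (κ k) y - chartFun (c j) (κ j) y = μ j * (h y - β * D y) := by
    intro j hj
    have e1 : chartFun ((μ j)⁻¹ • (c k - c j) - (μ j₀)⁻¹ • (c k - c j₀))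
        ((μ j)⁻¹ * (κ k - κ j) - (μ j₀)⁻¹ * (κ k - κ j₀)) x = 0 := by
      rw [chartFun_sub, chartFun_smul, chartFun_smul, hg0 j hj, hg0 j₀ hj₀]; ring
    have e2 : gradient (chartFun ((μ j)⁻¹ • (c k - c j) - (μ j₀)⁻¹ • (c k - c j₀))
        ((μ j)⁻¹ * (κ k - κ j) - (μ j₀)⁻¹ * (κ k - κ j₀))) x = 0 := by
      rw [gradient_chartFun_sub, gradient_chartFun_smul, gradient_chartFun_smul, hμgrad j hj,
        hμgrad j₀ hj₀, inv_smul_smul₀ (hμpos j hj).ne', inv_smul_smul₀ (hμpos j₀ hj₀).ne', sub_self]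
    refine ⟨((μ j)⁻¹ • (c k - c j) - (μ j₀)⁻¹ • (c k - c j₀)) 0 / Real.sqrt (1 + ‖x‖ ^ 2),
      fun y ↦ ?_⟩
    have e3 := chartFun_of_gradient_eq_zero e1 e2 y
    rw [chartFun_sub, chartFun_smul, chartFun_smul, sub_eq_iff_eq_add] at e3
    rw [← chartFun_sub, ← mul_inv_cancel_left₀ (hμpos j hj).ne'
      (chartFun (c k - c j) (κ k - κ j) y), e3]
    simp only [hh, hD]
    ring
  choose! β hβ using hβ
  -- Near `x`, the active constraints defining cell `k` read `h < β j D`, so the least `β` binds;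
  -- ties are broken by the largest `μ`.
  obtain ⟨j, hjA, hjmin⟩ := A.exists_min_image (fun j ↦ toLex (β j, -μ j)) ⟨j₀, hj₀⟩
  have hjk := ((hA j).1 hjA).1
  have hreg := gradient_ne_zero_of_nonempty hne hjk.symm (hg0 j hjA)
  have hO : ∀ᶠ y in 𝓝 x, ∀ l, l ∉ A → l ≠ k → chartFun (c k) (κ k) y < chartFun (c l) (κ l) y := by
    rw [eventually_all]
    intro l
    by_cases hl : l ∉ A ∧ l ≠ k
    · have : chartFun (c k) (κ k) x < chartFun (c l) (κ l) x :=
        lt_of_le_of_ne (hle l) fun h ↦ hl.1 ((hA l).2 ⟨hl.2, h⟩)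
      filter_upwards [((hcont k).tendsto x).eventually_lt ((hcont l).tendsto x) this] with y hy _ _
      exact hy
    · exact Eventually.of_forall fun y h1 h2 ↦ absurd ⟨h1, h2⟩ hl
  -- Several constraints may meet at `x` itself. Moving along the zero set of the binding one makes
  -- `D > 0`, which separates it from those with larger `β`.
  obtain ⟨y, hyO, hyx, hy0⟩ := exists_ne_mem_zero hn
    ((contDiff_chartFun _ _).differentiable (by simp)) (hg0 j hjA) hreg hO
  rw [chartFun_sub] at hy0
  refine ⟨j, hjk, y, by linarith, fun l hlk hlj ↦ ?_⟩
  by_cases hlA : l ∈ A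
  · have hDpos : 0 < D y := neg_mink_ofChart_pos hyx
    have hyj : h y - β j * D y = 0 := by
      rw [hβ j hjA] at hy0
      exact (mul_eq_zero.1 hy0).resolve_left (hμpos j hjA).ne'
    have hyl := hβ l hlA y
    have hmin := hjmin l hlA
    rw [Prod.Lex.toLex_le_toLex] at hmin
    rcases hmin with hlt | ⟨heq, hμle⟩
    · have : h y - β l * D y < 0 := by
        simp only at hlt
        nlinarith
      nlinarith [mul_pos (hμpos l hlA) (neg_pos.2 this)]
    -- With equal `β`, the differences for `l` and `j` are proportional. On cell `l` both are
    -- positive and the one for `l` is strictly larger, so `μ l > μ j`, against the choice of `j`.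
    · exfalso
      simp only at heq hμle
      obtain ⟨w, hw⟩ := hne l
      have w1 := hw k hlk.symm
      have w2 := hw j hlj.symm
      have w3 := hβ l hlA w
      have w4 := hβ j hjA w
      rw [← heq] at w3
      have hq : 0 < h w - β j * D w := by
        by_contra hcon
        push Not at hcon
        nlinarith [mul_nonneg (hμpos l hlA).le (neg_nonneg.2 hcon)]
      nlinarith
  · exact hyO l hlA hlk

/-! ### Interfaces, volume at infinity and the main theorem -/

theorem ofChart_space {n : ℕ} (y : Hyp n) : ofChart (space y.val) = y := by
  apply Hyp.ext
  ext i
  refine Fin.cases ?_ (fun i ↦ ?_) i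
  · have h : 1 + ‖space y.val‖ ^ 2 = y.val 0 ^ 2 := by rw [y.norm_space_sq]; ring
    simp only [ofChart, vec_zero]
    rw [h, Real.sqrt_sq y.time_pos.le]
  · simp [ofChart, vec, space]

/-- By continuity and finiteness only `j` competes near `x`, so the cell is locally the sublevel set
of a single regular function. -/
theorem mem_reducedBoundaryEuclidean_chartCell {n : ℕ} {ι : Type*} [Finite ι]
    {c : ι → Vec n} {κ : ι → ℝ} (hne : ∀ i, (chartCell c κ i).Nonempty)
    {τ : Measure (EuclideanSpace ℝ (Fin n))}
    {ν : EuclideanSpace ℝ (Fin n) → EuclideanSpace ℝ (Fin n)} {i j : ι} (hij : i ≠ j)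
    (hGG : IsGaussGreen (chartCell c κ i) τ ν) {x : EuclideanSpace ℝ (Fin n)}
    (hx : chartFun (c i) (κ i) x = chartFun (c j) (κ j) x)
    (hlt : ∀ l, l ≠ i → l ≠ j → chartFun (c i) (κ i) x < chartFun (c l) (κ l) x) :
    x ∈ reducedBoundaryEuclidean (chartCell c κ i) := by
  have h0 : chartFun (c i - c j) (κ i - κ j) x = 0 := by rw [chartFun_sub, hx, sub_self]
  have hcont : ∀ j, Continuous (chartFun (c j) (κ j)) := fun j ↦ (contDiff_chartFun _ _).continuous
  have hev : ∀ᶠ y in 𝓝 x, ∀ l, l ≠ i → l ≠ j →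
      chartFun (c i) (κ i) y < chartFun (c l) (κ l) y := by
    rw [eventually_all]
    intro l
    by_cases hl : l ≠ i ∧ l ≠ j
    · filter_upwards [((hcont i).tendsto x).eventually_lt ((hcont l).tendsto x)
        (hlt l hl.1 hl.2)] with y hy _ _
      exact hy
    · exact Eventually.of_forall fun y h1 h2 ↦ absurd ⟨h1, h2⟩ hl
  refine hGG.mem_reducedBoundaryEuclidean (contDiff_chartFun (c i - c j) (κ i - κ j)) ?_ h0
    (gradient_ne_zero_of_nonempty hne hij h0) (isOpen_chartCell c κ i).measurableSet
  filter_upwards [hev] with y hy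
  rw [chartFun_sub]
  constructor
  · intro h; linarith [h j hij.symm]
  · intro h l hl
    rcases eq_or_ne l j with rfl | hlj
    · linarith
    · exact hy l hl hlj

theorem IsVoronoiParam.preimage_ofChart {n : ℕ} {ι : Type*} {Ω : ι → Set (Hyp n)}
    {c : ι → Vec n} {κ : ι → ℝ} (h : IsVoronoiParam Ω c κ) (i : ι) :
    ofChart ⁻¹' Ω i = chartCell c κ i := by
  rw [h.cell i]
  ext x
  simp only [mem_preimage, mem_ofPred_eq, mink_ofChart, chartCell]

theorem IsVoronoiParam.chartCell_nonempty {n : ℕ} {ι : Type*} {Ω : ι → Set (Hyp n)}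
    {c : ι → Vec n} {κ : ι → ℝ} (h : IsVoronoiParam Ω c κ) (hne : ∀ i, (Ω i).Nonempty) (i : ι) :
    (chartCell c κ i).Nonempty := by
  obtain ⟨y, hy⟩ := hne i
  refine ⟨space y.val, ?_⟩
  rw [← h.preimage_ofChart i, mem_preimage, ofChart_space]
  exact hy

/-- Every cell of a spherical Voronoi partition with at least two cells has a non-empty
interface. -/
theorem IsVoronoiParam.exists_interface_nonempty {n : ℕ} (hn : 2 ≤ n) {ι : Type*} [Finite ι]
    {Ω : ι → Set (Hyp n)} {c : ι → Vec n} {κ : ι → ℝ} (h : IsVoronoiParam Ω c κ)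
    (hP : IsPartition Ω) (hne : ∀ i, (Ω i).Nonempty) {k i : ι} (hik : i ≠ k) :
    ∃ j, j ≠ k ∧ (interface Ω k j).Nonempty := by
  have hne' := h.chartCell_nonempty hne
  obtain ⟨j, hjk, x, hx, hlt⟩ := exists_regular_boundary_point hn hne' hik
  refine ⟨j, hjk, ofChart x, ?_, ?_⟩
  · obtain ⟨τ, ν, hGG⟩ := hP.perimeter k
    rw [h.preimage_ofChart] at hGG
    change space (ofChart x).val ∈ reducedBoundaryEuclidean _
    rw [space_ofChart, h.preimage_ofChart]
    exact mem_reducedBoundaryEuclidean_chartCell hne' hjk.symm hGG hx hlt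
  · obtain ⟨τ, ν, hGG⟩ := hP.perimeter j
    rw [h.preimage_ofChart] at hGG
    change space (ofChart x).val ∈ reducedBoundaryEuclidean _
    rw [space_ofChart, h.preimage_ofChart]
    exact mem_reducedBoundaryEuclidean_chartCell hne' hjk hGG hx.symm
      fun l hlj hlk ↦ hx ▸ hlt l hlk hlj

/-! ### Volume growth and the behaviour of the cells at infinity -/

/-- Hyperbolic volume, in the graph chart. -/
def chartVolume (n : ℕ) : Measure (EuclideanSpace ℝ (Fin n)) :=
  volume.withDensity fun x ↦ ENNReal.ofReal (1 / Real.sqrt (1 + ‖x‖ ^ 2))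

theorem hypVolume_eq {n : ℕ} (U : Set (Hyp n)) :
    hypVolume U = chartVolume n (ofChart ⁻¹' U) := by
  rw [chartVolume, withDensity_apply']
  rfl

/-- On the ball `|x| ≤ 2t`, so the density is at least `1 / (3t)`, against a Lebesgue volume of
order `(δt)ⁿ`. With `n ≥ 2` and `δt ≥ 1` the quotient grows at least linearly in `t`. -/
theorem le_chartVolume_ball {n : ℕ} (hn : 2 ≤ n) {e : EuclideanSpace ℝ (Fin n)} (he : ‖e‖ = 1)
    {δ t : ℝ} (hδ : δ ≤ 1) (ht : 1 ≤ t) (hδt : 1 ≤ δ * t) :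
    ENNReal.ofReal (δ ^ 2 * t / 3) * volume (Metric.ball (0 : EuclideanSpace ℝ (Fin n)) 1)
      ≤ chartVolume n (Metric.ball (t • e) (δ * t)) := by
  have h1 : ∀ x ∈ Metric.ball (t • e) (δ * t),
      ENNReal.ofReal (1 / (3 * t)) ≤ ENNReal.ofReal (1 / Real.sqrt (1 + ‖x‖ ^ 2)) := by
    intro x hx
    rw [mem_ball_iff_norm] at hx
    have hxn : ‖x‖ ≤ 2 * t := by
      have h2 := norm_add_le (x - t • e) (t • e)
      rw [sub_add_cancel, norm_smul, he, Real.norm_of_nonneg (by linarith)] at h2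
      nlinarith
    have : Real.sqrt (1 + ‖x‖ ^ 2) ≤ 3 * t := by
      rw [Real.sqrt_le_left (by linarith)]
      nlinarith [norm_nonneg x]
    exact ENNReal.ofReal_le_ofReal (one_div_le_one_div_of_le (by positivity) this)
  rw [chartVolume, withDensity_apply']
  refine le_trans ?_ (setLIntegral_mono_ae' measurableSet_ball (Eventually.of_forall h1))
  rw [setLIntegral_const, Measure.addHaar_ball_of_pos volume (t • e) (by linarith),
    finrank_euclideanSpace_fin, ← mul_assoc, ← ENNReal.ofReal_mul (by positivity)]
  gcongr
  have h2 : (δ * t) ^ 2 ≤ (δ * t) ^ n := pow_le_pow_right₀ hδt hn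
  calc δ ^ 2 * t / 3 = 1 / (3 * t) * (δ * t) ^ 2 := by field_simp
    _ ≤ _ := by gcongr

theorem exists_chartFun_pos {n : ℕ} {c : Vec n} (κ : ℝ) {e : EuclideanSpace ℝ (Fin n)}
    (he : ‖e‖ = 1) (h : c 0 < inner ℝ (space c) e) :
    ∃ δ : ℝ, 0 < δ ∧ δ ≤ 1 ∧ ∃ T : ℝ, ∀ t, T ≤ t → 0 < t →
      ∀ x ∈ Metric.ball (t • e) (δ * t), 0 < chartFun c κ x := by
  set η := inner ℝ (space c) e - c 0 with hη
  have hη0 : 0 < η := by linarith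
  set M := ‖space c‖ + |c 0| + 1 with hM
  have hM0 : 0 < M := by positivity
  -- Along the ray the function grows like `η t`. The choice of `δ` lets deviations within the ball
  -- cost at most `η t / 2`, and the threshold makes the other half exceed the bounded errors `|c 0|
  -- + |κ|`.
  refine ⟨min 1 (η / (2 * M)), by positivity, min_le_left _ _, 2 * (|c 0| + |κ| + 1) / η,
    fun t hT ht x hx ↦ ?_⟩
  set δ := min 1 (η / (2 * M))
  have hδ : δ * M ≤ η / 2 := by
    calc δ * M ≤ η / (2 * M) * M := by gcongr; exact min_le_right _ _
      _ = η / 2 := by field_simp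
  rw [mem_ball_iff_norm] at hx
  rw [div_le_iff₀ hη0] at hT
  have h1 : inner ℝ (space c) x = t * inner ℝ (space c) e + inner ℝ (space c) (x - t • e) := by
    rw [inner_sub_right, real_inner_smul_right]; ring
  have h2 : -(‖space c‖ * (δ * t)) ≤ inner ℝ (space c) (x - t • e) := by
    have := (abs_le.1 (abs_real_inner_le_norm (space c) (x - t • e))).1
    have : ‖space c‖ * ‖x - t • e‖ ≤ ‖space c‖ * (δ * t) := by gcongr
    linarith
  have hte : ‖t • e‖ = t := by rw [norm_smul, he, Real.norm_of_nonneg ht.le, mul_one]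
  have h3 : |Real.sqrt (1 + ‖x‖ ^ 2) - t| ≤ 1 + δ * t := by
    have e1 := norm_add_le (x - t • e) (t • e)
    rw [sub_add_cancel, hte] at e1
    have e2 := norm_sub_norm_le (t • e) x
    rw [hte, norm_sub_rev] at e2
    have e3 : Real.sqrt (1 + ‖x‖ ^ 2) ≤ 1 + ‖x‖ := by
      rw [Real.sqrt_le_left (by positivity)]
      nlinarith [norm_nonneg x]
    have e4 : ‖x‖ ≤ Real.sqrt (1 + ‖x‖ ^ 2) := Real.le_sqrt_of_sq_le (by linarith)
    rw [abs_le]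
    constructor <;> linarith
  have h4 : c 0 * Real.sqrt (1 + ‖x‖ ^ 2) ≤ c 0 * t + |c 0| * (1 + δ * t) := by
    have e1 := le_abs_self (c 0 * (Real.sqrt (1 + ‖x‖ ^ 2) - t))
    rw [abs_mul] at e1
    have e2 : |c 0| * |Real.sqrt (1 + ‖x‖ ^ 2) - t| ≤ |c 0| * (1 + δ * t) := by gcongr
    linarith
  have h5 : δ * t * M ≤ η / 2 * t := by nlinarith
  have h6 := le_abs_self κ
  have h7 : 0 < δ * t := lt_of_le_of_lt (norm_nonneg _) hx
  unfold chartFun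
  rw [h1]
  have h8 : t * inner ℝ (space c) e = t * η + t * c 0 := by rw [hη]; ring
  rw [hM] at h5
  nlinarith

/-- Near infinity, the exterior cell of a spherical Voronoi cluster is the minimal one. -/
theorem IsVoronoiParam.inner_space_le {n k : ℕ} (hn : 2 ≤ n) {Ω : Fin (k + 1) → Set (Hyp n)}
    (hΩ : IsCluster Ω) {c : Fin (k + 1) → Vec n} {κ : Fin (k + 1) → ℝ}
    (h : IsVoronoiParam Ω c κ) {j : Fin (k + 1)} (hj : j ≠ Fin.last k)
    {e : EuclideanSpace ℝ (Fin n)} (he : ‖e‖ = 1) :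
    inner ℝ (space (c (Fin.last k) - c j)) e ≤ (c (Fin.last k) - c j) 0 := by
  by_contra hlt
  push Not at hlt
  obtain ⟨δ, hδ0, hδ1, T, hT⟩ := exists_chartFun_pos (κ (Fin.last k) - κ j) he hlt
  set C := ∑ i ∈ Finset.univ.filter (fun i ↦ i ≠ Fin.last k), hypVolume (Ω i) with hC
  have hCfin : C < ⊤ := ENNReal.sum_lt_top.2 fun i hi ↦
    hΩ.finite_volume i (Finset.mem_filter.1 hi).2
  set b := volume (Metric.ball (0 : EuclideanSpace ℝ (Fin n)) 1) with hb
  have hb0 : 0 < b := Metric.measure_ball_pos _ _ one_pos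
  have hbfin : b < ⊤ := measure_ball_lt_top
  -- On these balls cell `j` beats the exterior cell, so up to a null set they are covered by
  -- bubbles of total volume `C`. The resulting bound is linear in `t`, hence absurd for large `t`.
  have key : ∀ t, T ≤ t → 1 ≤ t → 1 ≤ δ * t → δ ^ 2 * t / 3 * b.toReal ≤ C.toReal := by
    intro t ht1 ht2 ht3
    have hsub : Metric.ball (t • e) (δ * t) ⊆
        (⋃ i ∈ Finset.univ.filter (fun i ↦ i ≠ Fin.last k), ofChart ⁻¹' Ω i) ∪
          ofChart ⁻¹' (⋃ i, Ω i)ᶜ := by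
      intro x hx
      have hpos := hT t ht1 (by linarith) x hx
      by_cases hxU : ofChart x ∈ ⋃ i, Ω i
      · obtain ⟨i, hi⟩ := mem_iUnion.1 hxU
        refine Or.inl (mem_biUnion (x := i) ?_ hi)
        simp only [Finset.coe_filter, Finset.mem_univ, true_and, mem_ofPred_eq]
        rintro rfl
        have hx' : x ∈ ofChart ⁻¹' Ω (Fin.last k) := hi
        rw [h.preimage_ofChart] at hx'
        have := hx' j hj
        rw [chartFun_sub] at hpos
        linarith
      · exact Or.inr hxU
    have hle : chartVolume n (Metric.ball (t • e) (δ * t)) ≤ C := by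
      refine (measure_mono hsub).trans ((measure_union_le _ _).trans ?_)
      rw [← hypVolume_eq, hΩ.partition.cover, add_zero, hC]
      simp_rw [hypVolume_eq]
      exact measure_biUnion_finset_le _ _
    have := ENNReal.toReal_mono hCfin.ne ((le_chartVolume_ball hn he hδ1 ht2 ht3).trans hle)
    rwa [ENNReal.toReal_mul, ENNReal.toReal_ofReal (by positivity)] at this
  have hb1 : 0 < b.toReal := ENNReal.toReal_pos hb0.ne' hbfin.ne
  set q := δ ^ 2 / 3 * b.toReal with hq
  have hq0 : 0 < q := by positivity
  set t := max (max T 1) (max (1 / δ) ((C.toReal + 1) / q)) with ht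
  have h1 : T ≤ t := (le_max_left _ _).trans (le_max_left _ _)
  have h2 : 1 ≤ t := (le_max_right _ _).trans (le_max_left _ _)
  have h3 : 1 / δ ≤ t := (le_max_left _ _).trans (le_max_right _ _)
  have h4 : (C.toReal + 1) / q ≤ t := (le_max_right _ _).trans (le_max_right _ _)
  rw [div_le_iff₀ hδ0] at h3
  rw [div_le_iff₀ hq0] at h4
  have h5 := key t h1 h2 (by linarith)
  have h6 : δ ^ 2 * t / 3 * b.toReal = t * q := by rw [hq]; ring
  linarith

theorem norm_space_le {n : ℕ} {c : Vec n} (hn : 0 < n)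
    (h : ∀ e : EuclideanSpace ℝ (Fin n), ‖e‖ = 1 → inner ℝ (space c) e ≤ c 0) :
    ‖space c‖ ≤ c 0 := by
  rcases eq_or_ne (space c) 0 with h0 | h0
  · have := h (EuclideanSpace.single ⟨0, hn⟩ 1) (by simp)
    rw [h0, inner_zero_left] at this
    rwa [h0, norm_zero]
  · have := h (‖space c‖⁻¹ • space c) (norm_smul_inv_norm h0)
    rw [real_inner_smul_right, real_inner_self_eq_norm_sq] at this
    have hp := norm_pos_iff.2 h0
    have e : ‖space c‖⁻¹ * ‖space c‖ ^ 2 = ‖space c‖ := by field_simp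
    rwa [e] at this

theorem IsAdmissible.time_pos {n k : ℕ} (hn : 2 ≤ n) (hk : 1 ≤ k) {Ω : Fin (k + 1) → Set (Hyp n)}
    (hΩ : IsCluster Ω) (hne : ∀ i, (Ω i).Nonempty) {c : Fin (k + 1) → Vec n}
    {κ : Fin (k + 1) → ℝ} (h : IsVoronoiParam Ω c κ) {ξ : Vec n} (hξ : IsAdmissible Ω c κ ξ) :
    0 < ξ 0 := by
  have h0 : (0 : Fin (k + 1)) ≠ Fin.last k := by
    rw [ne_eq, Fin.ext_iff]; simp; omega
  obtain ⟨j, hj, hint⟩ := h.exists_interface_nonempty hn hΩ.partition hne h0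
  have hadm := hξ.2 _ _ hj.symm hint
  have hnorm := norm_space_le (by omega) fun e he ↦ h.inner_space_le hn hΩ hj he
  obtain ⟨x, hx⟩ := h.chartCell_nonempty hne j
  have hpos : 0 < chartFun (c (Fin.last k) - c j) (κ (Fin.last k) - κ j) x := by
    rw [chartFun_sub]; linarith [hx _ hj.symm]
  obtain ⟨z, hz⟩ := h.chartCell_nonempty hne (Fin.last k)
  have hneg : chartFun (c (Fin.last k) - c j) (κ (Fin.last k) - κ j) z < 0 := by
    rw [chartFun_sub]; linarith [hz _ hj]
  set d := c (Fin.last k) - c j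
  set l := κ (Fin.last k) - κ j
  have hd0 : 0 ≤ d 0 := (norm_nonneg _).trans hnorm
  unfold chartFun at hpos hneg
  -- `|d̲| ≤ d₀` and `|x| ≤ √(1 + |x|²)` make the linear part nonpositive, so positivity at `x` must
  -- come from `-l`.
  have hl : l < 0 := by
    have e1 := real_inner_le_norm (space d) x
    have e2 : ‖x‖ ≤ Real.sqrt (1 + ‖x‖ ^ 2) := Real.le_sqrt_of_sq_le (by linarith)
    have e3 : ‖space d‖ * ‖x‖ ≤ d 0 * Real.sqrt (1 + ‖x‖ ^ 2) := by gcongr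
    linarith
  have hξ1 : ‖space ξ‖ < 1 := by
    have := norm_sq_eq ξ
    have h1 := hξ.1
    have h2 : ‖ξ‖ ^ 2 < 1 := by nlinarith [norm_nonneg ξ]
    nlinarith [norm_nonneg (space ξ), sq_nonneg (ξ 0)]
  by_contra hcon
  push Not at hcon
  simp only [mink, space_vec, vec_zero] at hadm
  have e1 := real_inner_le_norm (space d) (space ξ)
  have e2 : ‖space d‖ * ‖space ξ‖ ≤ d 0 * ‖space ξ‖ := by gcongr
  have e3 : 0 ≤ l * ξ 0 := mul_nonneg_of_nonpos_of_nonpos hl.le hcon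
  -- Admissibility gives `0 ≤ l ξ₀ ≤ d₀ (|ξ̲| - 1)`, while `|ξ̲| < 1` and `d₀ ≥ 0`.
  have hd : d 0 = 0 := by nlinarith
  have hs : space d = 0 := by
    rw [hd] at hnorm
    exact norm_le_zero_iff.1 hnorm
  rw [hd, hs, inner_zero_left] at hneg
  linarith

/-! ### The potential and its Jacobi operator -/

theorem potential_pos {n : ℕ} {ξ : Vec n} (hξ : ‖ξ‖ < 1) (y : Hyp n) :
    0 < potential ξ y.val := by
  have hy := y.norm_space_sq
  have hy0 := y.time_pos
  have hn := norm_sq_eq ξ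
  have h1 := real_inner_le_norm (space y.val) (space ξ)
  have h2 : ‖ξ‖ ^ 2 < 1 := by nlinarith [norm_nonneg ξ]
  -- Cauchy-Schwarz for `ξ` and `(y̲, 1)`, whose Euclidean norm is `y₀`; the square supplied below
  -- is the Lagrange identity.
  have h3 : ‖space y.val‖ * ‖space ξ‖ + ξ 0 < y.val 0 := by
    refine lt_of_pow_lt_pow_left₀ 2 hy0.le ?_
    nlinarith [sq_nonneg (‖space ξ‖ - ‖space y.val‖ * ξ 0),
      mul_pos (sub_pos.2 h2) (pow_pos hy0 2)]
  simp only [potential, mink, space_vec, vec_zero]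
  linarith

/-- With `Z = (ξ̲, 1)`, the second derivative along each geodesic is `-⟨p, Z⟩₁`, whatever the
direction. By `hν` the normal derivative is `κ V(p)`, so the mean-curvature term cancels `(n-1) κ²
V`, and the Hessian and Ricci terms leave `(n-1) ξ₀`. -/
theorem jacobi_potential {n : ℕ} (hn : 1 ≤ n) (ξ : Vec n) (p : Hyp n) (ν : Vec n) (κ : ℝ)
    (hν : mink ν (vec (space ξ) 1) = κ * ξ 0 + κ * mink p.val (vec (space ξ) 1))
    (e : Fin (n - 1) → Vec n) :
    jacobi (potential ξ) p ν κ e = ((n : ℝ) - 1) * ξ 0 := by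
  set Z := vec (space ξ) 1 with hZ
  have hf : ∀ (u : Vec n) (s : ℝ), potential ξ (Real.cosh s • p.val + Real.sinh s • u)
      = -ξ 0 - (Real.cosh s * mink p.val Z + Real.sinh s * mink u Z) := fun u s ↦ by
    rw [potential, mink_add_left, mink_smul_left, mink_smul_left]
  have hd : ∀ u : Vec n, deriv (fun s : ℝ ↦ potential ξ (Real.cosh s • p.val + Real.sinh s • u))
      = fun s ↦ -(Real.sinh s * mink p.val Z + Real.cosh s * mink u Z) := fun u ↦ by
    funext s
    simp_rw [hf]
    exact ((((Real.hasDerivAt_cosh s).mul_const _).add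
      ((Real.hasDerivAt_sinh s).mul_const _)).const_sub _).deriv
  have hd2 : ∀ u : Vec n,
      iteratedDeriv 2 (fun s : ℝ ↦ potential ξ (Real.cosh s • p.val + Real.sinh s • u)) 0
        = -mink p.val Z := fun u ↦ by
    rw [iteratedDeriv_succ, iteratedDeriv_one, hd]
    have := ((((Real.hasDerivAt_sinh 0).mul_const (mink p.val Z)).add
      ((Real.hasDerivAt_cosh 0).mul_const (mink u Z))).neg).deriv
    refine Eq.trans this ?_
    simp
  unfold jacobi
  simp_rw [hd2, hd]
  rw [Finset.sum_const, Finset.card_univ, Fintype.card_fin, nsmul_eq_mul, Nat.cast_sub hn, potential,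
    ← hZ, hν]
  simp
  ring

end HypVoronoi

end

theorem mainTheorem7 (n k : ℕ) (hn : 2 ≤ n) (hk : 1 ≤ k)
    (Ω : Fin (k + 1) → Set (HypVoronoi.Hyp n))
    (hcluster : HypVoronoi.IsCluster Ω)
    (hvoronoi : HypVoronoi.IsSphericalVoronoi Ω)
    (hflat : HypVoronoi.IsMobiusFlat Ω) :
    HypVoronoi.IsEpiMobiusFlat Ω ∧
    ∀ c κ, HypVoronoi.IsVoronoiParam Ω c κ → ∀ ξ, HypVoronoi.IsAdmissible Ω c κ ξ →
      0 < ξ 0 ∧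
      (∀ y : HypVoronoi.Hyp n, 0 < HypVoronoi.potential ξ y.val) ∧
      ∀ i j, i ≠ j → ∀ p ∈ HypVoronoi.interface Ω i j, ∀ e,
        HypVoronoi.IsTangentFrame p (c i - c j + (κ i - κ j) • p.val) e →
          HypVoronoi.jacobi (HypVoronoi.potential ξ) p (c i - c j + (κ i - κ j) • p.val)
            (κ i - κ j) e = ((n : ℝ) - 1) * ξ 0 := by
  refine ⟨⟨hvoronoi, hflat, ?_⟩, fun c κ h ξ hξ ↦
    ⟨hξ.time_pos hn hk hcluster hvoronoi.nonempty h, HypVoronoi.potential_pos hξ.1,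
      fun i j hij p hp e _ ↦ HypVoronoi.jacobi_potential (by omega) ξ p _ _ ?_ e⟩⟩
  · rintro ⟨-, -, c, κ, h, ξ, hξ, hξ0⟩
    exact absurd (hξ.time_pos hn hk hcluster hvoronoi.nonempty h) (not_lt.2 hξ0)
  -- For the normal `cᵢⱼ + κᵢⱼ p`, the required value of `⟨ν, (ξ̲, 1)⟩₁` is exactly the
  -- admissibility equation.
  · have := hξ.2 i j hij ⟨p, hp⟩
    rw [HypVoronoi.mink_add_left, HypVoronoi.mink_smul_left]
    linarith
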